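/- Let $1\le \ell\le k$ be integers. A generic $\ell$-parameter unfolding (of a parabolic point of codimension $k$) is a germ at $(z,\epsilon)=(0,0)\in\mathbb C\times\mathbb C^\ell$ of an analytic family of vector fields $\dot z=\omega_\epsilon(z)=\sum_{n\ge0}c_n(\epsilon)z^n$, $\epsilon=(\epsilon_{\ell-1},\dots,\epsilon_0)$, with $\omega_0(z)=z^{k+1}+O(z^{k+2})$ and Jacobian determinant $\left|\frac{\partial(c_{\ell-1},\dots,c_0)}{\partial(\epsilon_{\ell-1},\dots,\epsilon_0)}\right|\ne0$ at $\epsilon=0$. A conjugacy between two families $\omega_{1,\epsilon}$ and $\omega_{2,\eta}$ is a germ at the origin of an analytic change of coordinate and parameter $(z,\epsilon)\mapsto(\varphi(z,\epsilon),h(\epsilon))$ with $\varphi(0,0)=0$, $h(0)=0$, $\partial_z\varphi(0,0)\neq0$, $dh(0)$ invertible, such that $\partial_z\varphi(z,\epsilon)\,\omega_{1,\epsilon}(z)=\omega_{2,h(\epsilon)}(\varphi(z,\epsilon))$ near the origin. A Kostov normal form of $\omega_\epsilon$ is a family, conjugate to $\omega_\epsilon$, of the form $$\dot z=\frac{z^{k+1}+b_{k-1}(\epsilon)z^{k-1}+\dots+b_1(\epsilon)z+b_0(\epsilon)}{1+A(\epsilon)z^k},$$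 with $A$ and all $b_j$ analytic near $\epsilon=0$, $b_j(0)=0$ for all $j$, and $b_j(\epsilon)=\epsilon_j$ for $0\le j\le\ell-1$. Theorem. Let $\omega_{1,\epsilon}$ and $\omega_{2,\eta}$ be two generic $\ell$-parameter unfoldings of parabolic points of codimension $k$. Then each of them has a Kostov normal form. Moreover, for any Kostov normal forms $N_1$ of $\omega_{1,\epsilon}$ and $N_2$ of $\omega_{2,\eta}$, the families $\omega_{1,\epsilon}$ and $\omega_{2,\eta}$ are conjugate if and only if there is $\mu\in\mathbb C$ with $\mu^k=1$ such that $$(z,\epsilon)\mapsto\left(\mu z,\ (\mu^{-(\ell-2)}\epsilon_{\ell-1},\dots,\epsilon_1,\mu\epsilon_0)\right),\qquad\text{i.e. } z\mapsto\mu z,\ \ \epsilon_j\mapsto\mu^{1-j}\epsilon_j,$$ is a conjugacy between $N_1$ and $N_2$. -/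

import Mathlib

open Filter Topology Asymptotics

noncomputable section

namespace ParabolicUnfolding

/-- A family `z' = ω ε z` of vector fields near `0 ∈ ℂ`, depending on `ℓ` complex parameters
`ε = (ε₀, …, ε_{ℓ-1})`. Only its germ at `(ε, z) = (0, 0)` is ever used. -/
abbrev Family (ℓ : ℕ) : Type := (Fin ℓ → ℂ) → ℂ → ℂ

/-- The Taylor coefficient `c_n(ε)` in `ω_ε(z) = ∑ c_n(ε) z^n`. -/
def coeff {ℓ : ℕ} (ω : Family ℓ) (n : ℕ) (ε : Fin ℓ → ℂ) : ℂ :=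
  iteratedDeriv n (ω ε) 0 / (n.factorial : ℂ)

/-- The Jacobian matrix `∂(c_0, …, c_{ℓ-1}) / ∂(ε_0, …, ε_{ℓ-1})` at `ε = 0`. -/
def jacobian {ℓ : ℕ} (ω : Family ℓ) : Matrix (Fin ℓ) (Fin ℓ) ℂ :=
  Matrix.of fun i j => fderiv ℂ (coeff ω i) 0 (Pi.single j 1)

/-- `ω` is (a representative of) a germ of analytic generic `ℓ`-parameter unfolding of a vector
field `ω_0(z) = z^{k+1} + O(z^{k+2})` with a parabolic singularity of codimension `k`. -/
structure IsGenericUnfolding (k : ℕ) {ℓ : ℕ} (ω : Family ℓ) : Prop where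
  analytic : AnalyticAt ℂ (fun p : (Fin ℓ → ℂ) × ℂ => ω p.1 p.2) (0, 0)
  parabolic : (fun z : ℂ => ω 0 z - z ^ (k + 1)) =O[𝓝 0] fun z : ℂ => z ^ (k + 2)
  generic : (jacobian ω).det ≠ 0

/-- The germ at the origin of the map `(z, ε) ↦ (φ ε z, h ε)` is an analytic change of coordinate
and parameter fixing the origin, and it carries the family `ω₁` to the family `ω₂`
(with the same time). -/
structure IsConjugacy {ℓ : ℕ} (φ : (Fin ℓ → ℂ) → ℂ → ℂ) (h : (Fin ℓ → ℂ) → (Fin ℓ → ℂ))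
    (ω₁ ω₂ : Family ℓ) : Prop where
  analytic_coord : AnalyticAt ℂ (fun p : (Fin ℓ → ℂ) × ℂ => φ p.1 p.2) (0, 0)
  coord_zero : φ 0 0 = 0
  deriv_coord_ne_zero : deriv (φ 0) 0 ≠ 0
  analytic_param : AnalyticAt ℂ h 0
  param_zero : h 0 = 0
  bijective_fderiv_param : Function.Bijective (fderiv ℂ h 0)
  conj : ∀ᶠ p : (Fin ℓ → ℂ) × ℂ in 𝓝 (0, 0),
    deriv (φ p.1) p.2 * ω₁ p.1 p.2 = ω₂ (h p.1) (φ p.1 p.2)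

/-- The germs of `ω₁` and `ω₂` are conjugate under an analytic change of coordinate and
parameter. -/
def Conjugate {ℓ : ℕ} (ω₁ ω₂ : Family ℓ) : Prop :=
  ∃ φ h, IsConjugacy φ h ω₁ ω₂

/-- The germ of `N` is a Kostov normal form
`z' = (z^{k+1} + b_{k-1}(ε) z^{k-1} + ⋯ + b_1(ε) z + b_0(ε)) / (1 + A(ε) z^k)`, with `A` and the
`b_j` analytic, `b_j(0) = 0` for all `j`, and `b_j(ε) = ε_j` for `j ≤ ℓ - 1`. -/
def IsKostovForm (k : ℕ) {ℓ : ℕ} (N : Family ℓ) : Prop :=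
  ∃ (b : ℕ → (Fin ℓ → ℂ) → ℂ) (A : (Fin ℓ → ℂ) → ℂ),
    AnalyticAt ℂ A 0 ∧
    (∀ j < k, AnalyticAt ℂ (b j) 0 ∧ b j 0 = 0) ∧
    (∀ j : Fin ℓ, ∀ᶠ ε in 𝓝 (0 : Fin ℓ → ℂ), b j ε = ε j) ∧
    ∀ᶠ p : (Fin ℓ → ℂ) × ℂ in 𝓝 (0, 0),
      N p.1 p.2 = (p.2 ^ (k + 1) + ∑ j ∈ Finset.range k, b j p.1 * p.2 ^ j) /
        (1 + A p.1 * p.2 ^ k)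

/-- `N` is a Kostov normal form of the family `ω`. -/
def IsKostovFormOf (k : ℕ) {ℓ : ℕ} (ω N : Family ℓ) : Prop :=
  IsKostovForm k N ∧ Conjugate ω N

/-- The parameter scaling
`(ε_{ℓ-1}, …, ε_1, ε_0) ↦ (μ^{-(ℓ-2)} ε_{ℓ-1}, …, ε_1, μ ε_0)`, that is `ε_j ↦ μ^{1-j} ε_j`. -/
def scaleParam {ℓ : ℕ} (μ : ℂ) (ε : Fin ℓ → ℂ) : Fin ℓ → ℂ :=
  fun j => μ ^ (1 - ((j : ℕ) : ℤ)) * ε j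

end ParabolicUnfolding

end

noncomputable section

namespace ParabolicUnfolding

/-! Restrict to a small disc z = ζ w. The rescaled field f(w) = ζ^{-(k+1)} ω_ε(ζ w) is a small
perturbation of w^{k+1}. Writing a coordinate change as φ = w + c + ∫g, conjugacy to a normal form
is the equation φ' f (1 + a φ^k) = P_b(φ), where P_b(u) = u^{k+1} + ∑_{j<k} b_j u^j and the unknowns
are c, g, b, a. Because the unknown is g = φ' - 1, no derivative is lost, and the equation lives in
the Banach algebra of power series with summable coefficients.

The linearization at f = w^{k+1}, φ = w is diagonal on coefficients, apart from one resonance at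
w^{2k+1}, where g_k drops out and a takes its place. Prescribing the coefficient of w^{k+1} in φ
removes the resulting kernel, so the inverse function theorem applies (`bijective_linearization`,
`exists_localInverse`) and solutions depend analytically on f.

Uniqueness: for fixed f, the solutions near the base point form a curve parametrized by the
prescribed coefficient. Moving along it amounts to composing φ with the flow of f, which changes
neither b nor a (`exists_symmetry`, `normalForm_unique`). A conjugacy between two Kostov forms has
linear part μ with μ^k = 1. Dividing it by μ gives a map tangent to the identity, so uniqueness
yields b_{1,j}(ε) = μ^{j-1} b_{2,j}(h(ε)); for j < ℓ this says that h is the scaling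
(`exists_rotation_of_conjugate`).

Existence: the new parameters must be b_0, …, b_{ℓ-1}. A direction along which none of them moves to
first order also leaves c_0, …, c_{ℓ-1} stationary (`cf_eq_zero_of_residualDeriv_eq_zero`), so
genericity makes ε ↦ (b_j)_{j<ℓ} a local diffeomorphism
(`IsGenericUnfolding.exists_isKostovFormOf`). -/

/-- The algebra of power series `∑ a_n w^n` with `∑ ‖a_n‖ < ∞`, a Banach algebra of functions
on the closed unit disc. -/
def WienerAlgebra : Type := lp (fun _ : ℕ => ℂ) 1

/-! ### The Wiener algebra: Banach algebra structure, coefficients, integration. -/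

namespace WienerAlgebra

instance : NormedAddCommGroup WienerAlgebra :=
  inferInstanceAs (NormedAddCommGroup (lp (fun _ : ℕ => ℂ) 1))

instance : NormedSpace ℂ WienerAlgebra :=
  inferInstanceAs (NormedSpace ℂ (lp (fun _ : ℕ => ℂ) 1))

instance : CompleteSpace WienerAlgebra :=
  inferInstanceAs (CompleteSpace (lp (fun _ : ℕ => ℂ) 1))

/-- The power series of an element of the Wiener algebra. -/
def toPowerSeries (y : WienerAlgebra) : PowerSeries ℂ :=
  PowerSeries.mk (Subtype.val y : ℕ → ℂ)

/-- The coefficients of an element of the Wiener algebra. -/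
def cf (y : WienerAlgebra) (n : ℕ) : ℂ := (Subtype.val y : ℕ → ℂ) n

/-- The element of the Wiener algebra with given coefficients. -/
def ofCoeff (a : ℕ → ℂ) (ha : Summable fun n => ‖a n‖) : WienerAlgebra :=
  ⟨a, memℓp_gen (by simpa using ha)⟩

@[simp] lemma cf_ofCoeff (a : ℕ → ℂ) (ha : Summable fun n => ‖a n‖) (n : ℕ) :
    cf (ofCoeff a ha) n = a n := rfl

@[simp] lemma coeff_toPowerSeries (y : WienerAlgebra) (n : ℕ) :
    PowerSeries.coeff n (toPowerSeries y) = cf y n := by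
  simp [toPowerSeries, cf]

lemma ext_cf {x y : WienerAlgebra} (h : ∀ n, cf x n = cf y n) : x = y :=
  Subtype.ext (funext h)

lemma toPowerSeries_injective : Function.Injective toPowerSeries := fun x y h =>
  ext_cf fun n => by rw [← coeff_toPowerSeries, h, coeff_toPowerSeries]

lemma summable_norm (y : WienerAlgebra) : Summable fun n => ‖cf y n‖ := by
  simpa [cf] using (Subtype.property y : Memℓp _ _).summable (by simp)

lemma norm_eq_tsum (y : WienerAlgebra) : ‖y‖ = ∑' n, ‖cf y n‖ := by
  refine (lp.norm_eq_tsum_rpow (p := 1) (E := fun _ : ℕ => ℂ) (by simp) y).trans ?_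
  simp [cf]

lemma norm_cf_le (y : WienerAlgebra) (n : ℕ) : ‖cf y n‖ ≤ ‖y‖ := by
  rw [norm_eq_tsum]
  exact (summable_norm y).le_tsum n fun _ _ => norm_nonneg _

@[simp] lemma cf_add (x y : WienerAlgebra) (n : ℕ) : cf (x + y) n = cf x n + cf y n := rfl
@[simp] lemma cf_sub (x y : WienerAlgebra) (n : ℕ) : cf (x - y) n = cf x n - cf y n := rfl
@[simp] lemma cf_zero (n : ℕ) : cf 0 n = 0 := rfl
@[simp] lemma cf_smul (c : ℂ) (x : WienerAlgebra) (n : ℕ) : cf (c • x) n = c * cf x n := rfl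

lemma summable_norm_mul (x y : WienerAlgebra) : Summable fun n =>
    ‖∑ p ∈ Finset.HasAntidiagonal.antidiagonal n, cf x p.1 * cf y p.2‖ :=
  summable_norm_sum_mul_antidiagonal_of_summable_norm (summable_norm x) (summable_norm y)

instance : Mul WienerAlgebra where
  mul x y := ofCoeff _ (summable_norm_mul x y)

instance : One WienerAlgebra where
  one := ofCoeff (fun n => if n = 0 then 1 else 0)
    (summable_of_ne_finset_zero (s := {0}) fun n hn => by
      simp only [Finset.mem_singleton] at hn
      simp [hn])

lemma cf_mul (x y : WienerAlgebra) (n : ℕ) :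
    cf (x * y) n = ∑ p ∈ Finset.HasAntidiagonal.antidiagonal n, cf x p.1 * cf y p.2 := rfl

lemma cf_one (n : ℕ) : cf 1 n = if n = 0 then 1 else 0 := rfl

lemma toPowerSeries_mul (x y : WienerAlgebra) :
    toPowerSeries (x * y) = toPowerSeries x * toPowerSeries y := by
  ext n
  simp [PowerSeries.coeff_mul, cf_mul]

lemma toPowerSeries_one : toPowerSeries 1 = 1 := by
  ext n
  simp [PowerSeries.coeff_one, cf_one]

lemma toPowerSeries_add (x y : WienerAlgebra) :
    toPowerSeries (x + y) = toPowerSeries x + toPowerSeries y := by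
  ext n
  simp

lemma toPowerSeries_zero : toPowerSeries 0 = 0 := by
  ext n
  simp

lemma norm_mul_le_mul_norm (x y : WienerAlgebra) : ‖x * y‖ ≤ ‖x‖ * ‖y‖ := by
  have hx : Summable fun n => ‖‖cf x n‖‖ := by simpa using summable_norm x
  have hy : Summable fun n => ‖‖cf y n‖‖ := by simpa using summable_norm y
  rw [norm_eq_tsum, norm_eq_tsum x, norm_eq_tsum y,
    tsum_mul_tsum_eq_tsum_sum_antidiagonal_of_summable_norm hx hy]
  refine (summable_norm _).tsum_le_tsum (fun n => ?_) ?_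
  · rw [cf_mul]
    exact (norm_sum_le _ _).trans (Finset.sum_le_sum fun p _ => norm_mul_le _ _)
  · exact (summable_norm_sum_mul_antidiagonal_of_summable_norm hx hy).of_norm

instance : NormedCommRing WienerAlgebra :=
  { (inferInstance : NormedAddCommGroup WienerAlgebra) with
    mul_assoc := fun a b c => toPowerSeries_injective (by simp only [toPowerSeries_mul, mul_assoc])
    one_mul := fun a => toPowerSeries_injective (by
      simp only [toPowerSeries_mul, toPowerSeries_one, one_mul])
    mul_one := fun a => toPowerSeries_injective (by
      simp only [toPowerSeries_mul, toPowerSeries_one, mul_one])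
    left_distrib := fun a b c => toPowerSeries_injective (by
      simp only [toPowerSeries_mul, toPowerSeries_add, mul_add])
    right_distrib := fun a b c => toPowerSeries_injective (by
      simp only [toPowerSeries_mul, toPowerSeries_add, add_mul])
    zero_mul := fun a => toPowerSeries_injective (by
      simp only [toPowerSeries_mul, toPowerSeries_zero, zero_mul])
    mul_zero := fun a => toPowerSeries_injective (by
      simp only [toPowerSeries_mul, toPowerSeries_zero, mul_zero])
    mul_comm := fun a b => toPowerSeries_injective (by
      simp only [toPowerSeries_mul, mul_comm])
    norm_mul_le := norm_mul_le_mul_norm }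

instance : Algebra ℂ WienerAlgebra :=
  Algebra.ofModule
    (fun c x y => ext_cf fun n => by simp [cf_mul, Finset.mul_sum, mul_assoc])
    (fun c x y => ext_cf fun n => by simp [cf_mul, Finset.mul_sum, mul_left_comm])

instance : NormedAlgebra ℂ WienerAlgebra where
  norm_smul_le := norm_smul_le

/-- The inclusion of the Wiener algebra into formal power series. -/
def toPS : WienerAlgebra →ₐ[ℂ] PowerSeries ℂ where
  toFun := toPowerSeries
  map_one' := toPowerSeries_one
  map_mul' := toPowerSeries_mul
  map_zero' := toPowerSeries_zero
  map_add' := toPowerSeries_add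
  commutes' c := by
    rw [Algebra.algebraMap_eq_smul_one, Algebra.algebraMap_eq_smul_one]
    ext n
    simp [PowerSeries.coeff_one, cf_one]

@[simp] lemma coeff_toPS (y : WienerAlgebra) (n : ℕ) : PowerSeries.coeff n (toPS y) = cf y n :=
  coeff_toPowerSeries y n

/-- The `n`-th coefficient as a continuous linear functional. -/
def cfL (n : ℕ) : WienerAlgebra →L[ℂ] ℂ :=
  LinearMap.mkContinuous ⟨⟨fun y => cf y n, fun _ _ => rfl⟩, fun _ _ => rfl⟩ 1 fun y => by
    exact (norm_cf_le y n).trans_eq (one_mul _).symm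

@[simp] lemma cfL_apply (n : ℕ) (y : WienerAlgebra) : cfL n y = cf y n := rfl

lemma norm_cfL_le (n : ℕ) : ‖cfL n‖ ≤ 1 := LinearMap.mkContinuous_norm_le _ zero_le_one _

/-- The coordinate function `w`. -/
def W : WienerAlgebra := ofCoeff (fun n => if n = 1 then 1 else 0)
    (summable_of_ne_finset_zero (s := {1}) fun n hn => by
      simp only [Finset.mem_singleton] at hn
      simp [hn])

@[simp] lemma toPS_W : toPS W = PowerSeries.X := by
  ext n
  simp [W, PowerSeries.coeff_X]

lemma norm_W_le : ‖W‖ ≤ 1 := by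
  rw [norm_eq_tsum, tsum_eq_single 1]
  · simp [W]
  · intro n hn
    simp [W, hn]

lemma norm_one_le : ‖(1 : WienerAlgebra)‖ ≤ 1 := by
  rw [norm_eq_tsum, tsum_eq_single 0]
  · simp [cf_one]
  · intro n hn
    simp [cf_one, hn]

instance : NormOneClass WienerAlgebra where
  norm_one := by
    refine le_antisymm norm_one_le ?_
    have := norm_cf_le 1 0
    simpa [cf_one] using this

lemma norm_W_pow_le (n : ℕ) : ‖W ^ n‖ ≤ 1 :=
  (norm_pow_le _ _).trans (pow_le_one₀ (norm_nonneg _) norm_W_le)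

lemma cf_W_pow_mul (m n : ℕ) (y : WienerAlgebra) :
    cf (W ^ m * y) n = if m ≤ n then cf y (n - m) else 0 := by
  rw [← coeff_toPS, map_mul, map_pow, toPS_W, PowerSeries.coeff_X_pow_mul']
  simp

lemma cf_W_pow (m n : ℕ) : cf (W ^ m) n = if n = m then 1 else 0 := by
  rw [← coeff_toPS, map_pow, toPS_W, PowerSeries.coeff_X_pow]

/-- Integration `∑ a_n w^n ↦ ∑ a_n w^{n+1} / (n+1)`. -/
def integral : WienerAlgebra →L[ℂ] WienerAlgebra :=
  have hs (y : WienerAlgebra) (n : ℕ) : ‖cf y n / (n + 1 : ℂ)‖ ≤ ‖cf y n‖ := by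
    rw [norm_div]
    refine div_le_self (norm_nonneg _) ?_
    have : ((n : ℂ) + 1) = ((n + 1 : ℕ) : ℂ) := by push_cast; rfl
    rw [this, Complex.norm_natCast]
    exact_mod_cast Nat.le_add_left 1 n
  have hsum (y : WienerAlgebra) : Summable fun n => ‖cf y n / (n + 1 : ℂ)‖ :=
    Summable.of_nonneg_of_le (fun _ => norm_nonneg _) (hs y) (summable_norm y)
  LinearMap.mkContinuous
    { toFun := fun y => W * ofCoeff (fun n => cf y n / (n + 1)) (hsum y)
      map_add' := fun x y => by
        rw [← mul_add]
        congr 1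
        exact ext_cf fun n => by simp [add_div]
      map_smul' := fun c y => by
        rw [RingHom.id_apply, ← mul_smul_comm]
        congr 1
        exact ext_cf fun n => by simp [mul_div_assoc] } 1 fun y => by
    refine (norm_mul_le _ _).trans (mul_le_mul norm_W_le ?_ (norm_nonneg _) zero_le_one)
    rw [norm_eq_tsum, norm_eq_tsum]
    exact (hsum y).tsum_le_tsum (hs y) (summable_norm y)

lemma cf_integral_zero (y : WienerAlgebra) : cf (integral y) 0 = 0 := by
  change cf (W * _) 0 = 0
  rw [← pow_one W, cf_W_pow_mul]
  simp

lemma cf_integral_succ (y : WienerAlgebra) (n : ℕ) :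
    cf (integral y) (n + 1) = cf y n / (n + 1) := by
  change cf (W * _) (n + 1) = _
  rw [← pow_one W, cf_W_pow_mul]
  simp

/-- The function with value `x.1` at `0` and derivative `x.2`. -/
def primitive : ℂ × WienerAlgebra →L[ℂ] WienerAlgebra :=
  (ContinuousLinearMap.fst ℂ ℂ WienerAlgebra).smulRight 1 +
    integral ∘L ContinuousLinearMap.snd ℂ ℂ WienerAlgebra

lemma primitive_apply (x : ℂ × WienerAlgebra) : primitive x = x.1 • 1 + integral x.2 := rfl

lemma cf_primitive_zero (x : ℂ × WienerAlgebra) : cf (primitive x) 0 = x.1 := by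
  simp [primitive_apply, cf_integral_zero, cf_one]

lemma cf_primitive_succ (x : ℂ × WienerAlgebra) (n : ℕ) :
    cf (primitive x) (n + 1) = cf x.2 n / (n + 1) := by
  simp [primitive_apply, cf_integral_succ, cf_one]

lemma derivative_toPS_primitive (x : ℂ × WienerAlgebra) :
    PowerSeries.derivative ℂ (toPS (primitive x)) = toPS x.2 := by
  ext n
  rw [PowerSeries.coeff_derivative, coeff_toPS, coeff_toPS, cf_primitive_succ]
  field_simp

/-- Differentiation does not preserve the Wiener algebra, so the relation y' = g is expressed in
formal power series. When y' does lie in the algebra, this puts y in the form used by the conjugacy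
problem. -/
lemma primitive_eq_of_derivative {y g : WienerAlgebra}
    (h : PowerSeries.derivative ℂ (toPS y) = toPS g) : primitive (cf y 0, g) = y := by
  refine ext_cf fun n => ?_
  cases n with
  | zero => rw [cf_primitive_zero]
  | succ n =>
    have := congrArg (PowerSeries.coeff n) h
    rw [PowerSeries.coeff_derivative, coeff_toPS, coeff_toPS] at this
    rw [cf_primitive_succ, ← this]
    field_simp

end WienerAlgebra

/-! ### Evaluation at points of the disc. -/

namespace WienerAlgebra

/-- Evaluation at `w`, for `‖w‖ < 1`, as a continuous linear functional. -/
def ev (w : ℂ) : WienerAlgebra →L[ℂ] ℂ := ∑' n, w ^ n • cfL n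

lemma summable_ev {w : ℂ} (hw : ‖w‖ < 1) : Summable fun n => w ^ n • cfL n := by
  refine Summable.of_norm_bounded (summable_geometric_of_lt_one (norm_nonneg w) hw) fun n => ?_
  rw [norm_smul, norm_pow]
  exact mul_le_of_le_one_right (by positivity) (norm_cfL_le n)

lemma ev_apply {w : ℂ} (hw : ‖w‖ < 1) (y : WienerAlgebra) : ev w y = ∑' n, w ^ n * cf y n := by
  have := (ContinuousLinearMap.apply ℂ ℂ y).map_tsum (summable_ev hw)
  simpa [ev] using this

lemma summable_norm_ev {w : ℂ} (hw : ‖w‖ < 1) (y : WienerAlgebra) :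
    Summable fun n => ‖w ^ n * cf y n‖ := by
  refine Summable.of_nonneg_of_le (fun _ => norm_nonneg _) (fun n => ?_) (summable_norm y)
  rw [norm_mul, norm_pow]
  exact mul_le_of_le_one_left (norm_nonneg _) (pow_le_one₀ (norm_nonneg _) hw.le)

lemma ev_mul {w : ℂ} (hw : ‖w‖ < 1) (x y : WienerAlgebra) : ev w (x * y) = ev w x * ev w y := by
  rw [ev_apply hw, ev_apply hw, ev_apply hw,
    tsum_mul_tsum_eq_tsum_sum_antidiagonal_of_summable_norm (summable_norm_ev hw x)
      (summable_norm_ev hw y)]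
  refine tsum_congr fun n => ?_
  rw [cf_mul, Finset.mul_sum]
  refine Finset.sum_congr rfl fun p hp => ?_
  rw [← Finset.HasAntidiagonal.mem_antidiagonal.mp hp, pow_add]
  ring

lemma ev_W_pow {w : ℂ} (hw : ‖w‖ < 1) (m : ℕ) : ev w (W ^ m) = w ^ m := by
  rw [ev_apply hw, tsum_eq_single m]
  · simp [cf_W_pow]
  · intro n hn
    simp [cf_W_pow, hn]

lemma ev_one {w : ℂ} (hw : ‖w‖ < 1) : ev w 1 = 1 := by
  simpa using ev_W_pow hw 0

lemma ev_pow {w : ℂ} (hw : ‖w‖ < 1) (x : WienerAlgebra) (n : ℕ) : ev w (x ^ n) = ev w x ^ n := by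
  induction n with
  | zero => simp [ev_one hw]
  | succ n ih => rw [pow_succ, ev_mul hw, ih, pow_succ]

/-- Analyticity of w ↦ `ev w` is proved in the operator norm; pairing with the algebra then gives
joint analyticity in the element and the point. -/
lemma hasFPowerSeriesOnBall_ev : HasFPowerSeriesOnBall ev
    (fun n => ContinuousMultilinearMap.mkPiRing ℂ (Fin n) (cfL n)) 0 1 where
  r_le := by
    refine ENNReal.le_of_forall_nnreal_lt fun r hr => ?_
    refine FormalMultilinearSeries.le_radius_of_bound _ 1 fun n => ?_
    rw [ContinuousMultilinearMap.norm_mkPiRing]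
    have : (r : ℝ) ≤ 1 := by exact_mod_cast hr.le
    exact mul_le_one₀ (norm_cfL_le n) (by positivity) (pow_le_one₀ r.2 this)
  r_pos := one_pos
  hasSum := fun {y} hy => by
    have hy' : ‖y‖ < 1 := by simpa [← ofReal_norm] using hy
    simpa [ev] using (summable_ev hy').hasSum

lemma analyticAt_ev {w : ℂ} (hw : ‖w‖ < 1) : AnalyticAt ℂ ev w :=
  hasFPowerSeriesOnBall_ev.analyticAt_of_mem (by simpa [← ofReal_norm] using hw)

lemma analyticAt_ev_apply (p : WienerAlgebra × ℂ) (hp : ‖p.2‖ < 1) :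
    AnalyticAt ℂ (fun q : WienerAlgebra × ℂ => ev q.2 q.1) p :=
  AnalyticAt.fun_comp (g := fun q : (WienerAlgebra →L[ℂ] ℂ) × WienerAlgebra => q.1 q.2)
    (f := fun q : WienerAlgebra × ℂ => (ev q.2, q.1))
    ((ContinuousLinearMap.id ℂ (WienerAlgebra →L[ℂ] ℂ)).analyticAt_bilinear _)
    (((analyticAt_ev hp).fun_comp analyticAt_snd).prod analyticAt_fst)

lemma hasFPowerSeriesOnBall_ev_apply (y : WienerAlgebra) :
    HasFPowerSeriesOnBall (fun w => ev w y) (FormalMultilinearSeries.ofScalars ℂ (cf y)) 0 1 := by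
  convert! (ContinuousLinearMap.apply ℂ ℂ y).comp_hasFPowerSeriesOnBall
    hasFPowerSeriesOnBall_ev using 1
  ext n
  simp [FormalMultilinearSeries.ofScalars,
    ContinuousLinearMap.compFormalMultilinearSeries]

/-- Identity theorem: equations in the algebra may be checked pointwise near 0. -/
lemma eq_of_ev_eq {x y : WienerAlgebra} (h : ∀ᶠ w in 𝓝 (0 : ℂ), ev w x = ev w y) : x = y := by
  have hxy := HasFPowerSeriesAt.eq_formalMultilinearSeries_of_eventually
    (hasFPowerSeriesOnBall_ev_apply x).hasFPowerSeriesAt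
    (hasFPowerSeriesOnBall_ev_apply y).hasFPowerSeriesAt h
  have := FormalMultilinearSeries.ofScalars_series_injective ℂ ℂ hxy
  exact ext_cf fun n => congrFun this n

lemma cf_eq_iteratedDeriv {y : WienerAlgebra} {f : ℂ → ℂ} (h : ∀ᶠ w in 𝓝 (0 : ℂ), ev w y = f w)
    (n : ℕ) : cf y n = iteratedDeriv n f 0 / (n.factorial : ℂ) := by
  have h1 := (hasFPowerSeriesOnBall_ev_apply y).hasFPowerSeriesAt.congr h
  have := FormalMultilinearSeries.ofScalars_series_injective ℂ ℂ
    (h1.eq_formalMultilinearSeries h1.analyticAt.hasFPowerSeriesAt)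
  exact congrFun this n

lemma hasDerivAt_ev_primitive (x : ℂ × WienerAlgebra) {w : ℂ} (hw : ‖w‖ < 1) :
    HasDerivAt (fun w => ev w (primitive x)) (ev w x.2) w := by
  have h0 : (0 : ℂ) ∈ Metric.ball (0 : ℂ) 1 := by simp
  have hsum : HasDerivAt (fun w : ℂ => ∑' n, cf x.2 n / (n + 1) * w ^ (n + 1))
      (∑' n, cf x.2 n * w ^ n) w := by
    refine hasDerivAt_tsum_of_isPreconnected (g := fun n w => cf x.2 n / (n + 1) * w ^ (n + 1))
      (g' := fun n w => cf x.2 n * w ^ n) (summable_norm x.2) (Metric.isOpen_ball (x := (0 : ℂ)) (ε := 1))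
      (convex_ball (0 : ℂ) 1 : Convex ℝ _).isPreconnected (fun n y _ => ?_) (fun n y hy => ?_) h0 ?_
      (by simpa using hw)
    · have hn : (n : ℂ) + 1 ≠ 0 := by exact_mod_cast n.succ_ne_zero
      convert! (hasDerivAt_pow (n + 1) y).const_mul (cf x.2 n / (n + 1)) using 1
      push_cast
      field_simp
    · rw [norm_mul, norm_pow]
      exact mul_le_of_le_one_right (norm_nonneg _)
        (pow_le_one₀ (norm_nonneg _) (by simpa using (mem_ball_zero_iff.mp hy).le))
    · simp
  have heq : (fun w => ev w (primitive x)) =ᶠ[𝓝 w]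
      fun w : ℂ => x.1 + ∑' n, cf x.2 n / (n + 1) * w ^ (n + 1) := by
    filter_upwards [Metric.isOpen_ball.mem_nhds (mem_ball_zero_iff.mpr hw)] with v hv
    have hv : ‖v‖ < 1 := by simpa using hv
    rw [ev_apply hv, (summable_norm_ev hv _).of_norm.tsum_eq_zero_add]
    simp [cf_primitive_zero, cf_primitive_succ, mul_comm]
  refine HasDerivAt.congr_of_eventuallyEq ?_ heq
  rw [ev_apply hw]
  simpa [mul_comm] using hsum.const_add x.1

lemma ev_zero (y : WienerAlgebra) : ev 0 y = cf y 0 := by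
  rw [ev_apply (by simp), tsum_eq_single 0]
  · simp
  · intro n hn
    simp [hn]

lemma primitive_eq_of_hasDerivAt {y g : WienerAlgebra} {c : ℂ} (h0 : ev 0 y = c)
    (h : ∀ w : ℂ, ‖w‖ < 1 → HasDerivAt (fun w => ev w y) (ev w g) w) : primitive (c, g) = y := by
  refine eq_of_ev_eq ?_
  filter_upwards [Metric.ball_mem_nhds (0 : ℂ) one_pos] with w hw
  refine (Metric.isOpen_ball (x := (0 : ℂ)) (ε := 1)).eqOn_of_deriv_eq
    (f := fun w => ev w (primitive (c, g))) (g := fun w => ev w y) (convex_ball (0 : ℂ) 1 : Convex ℝ _).isPreconnected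
    (fun v hv => ?_) (fun v hv => ?_) (fun v hv => ?_) (Metric.mem_ball_self one_pos) ?_ hw
  · exact (hasDerivAt_ev_primitive _ (by simpa using hv)).differentiableAt.differentiableWithinAt
  · exact (h v (by simpa using hv)).differentiableAt.differentiableWithinAt
  · rw [(hasDerivAt_ev_primitive _ (by simpa using hv)).deriv, (h v (by simpa using hv)).deriv]
  · rw [ev_zero, cf_primitive_zero, h0]

/-! ### Analytic families as analytic maps into the Wiener algebra. -/

section Lift

variable {E : Type*} [NormedAddCommGroup E] [NormedSpace ℂ E]

/-- The power series of `(ε, ζ) ↦ (w ↦ ω (ε, ζ w))` in terms of the one of `ω`. -/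
def liftSeries (p : FormalMultilinearSeries ℂ (E × ℂ) ℂ) :
    FormalMultilinearSeries ℂ (E × ℂ) WienerAlgebra := fun n =>
  ∑ s : Finset (Fin n),
    ((ContinuousLinearMap.id ℂ ℂ).smulRight (W ^ s.card)).compContinuousMultilinearMap
      ((p n).compContinuousLinearMap fun i =>
        if i ∈ s then ContinuousLinearMap.inr ℂ E ℂ ∘L ContinuousLinearMap.snd ℂ E ℂ
        else ContinuousLinearMap.inl ℂ E ℂ ∘L ContinuousLinearMap.fst ℂ E ℂ)

/-- There are 2^n subsets of slots, and each term is bounded by `‖p n‖` since powers of `W` have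
norm at most 1. The only cost is a factor 2 in the guaranteed radius. -/
lemma norm_liftSeries_le (p : FormalMultilinearSeries ℂ (E × ℂ) ℂ) (n : ℕ) :
    ‖liftSeries p n‖ ≤ 2 ^ n * ‖p n‖ := by
  have h : ∀ s : Finset (Fin n),
      ‖((ContinuousLinearMap.id ℂ ℂ).smulRight (W ^ s.card)).compContinuousMultilinearMap
      ((p n).compContinuousLinearMap fun i =>
        if i ∈ s then ContinuousLinearMap.inr ℂ E ℂ ∘L ContinuousLinearMap.snd ℂ E ℂ
        else ContinuousLinearMap.inl ℂ E ℂ ∘L ContinuousLinearMap.fst ℂ E ℂ)‖ ≤ ‖p n‖ := by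
    intro s
    refine (ContinuousLinearMap.norm_compContinuousMultilinearMap_le _ _).trans ?_
    have h1 : ‖(ContinuousLinearMap.id ℂ ℂ).smulRight (W ^ s.card)‖ ≤ 1 := by
      rw [ContinuousLinearMap.norm_smulRight_apply]
      exact mul_le_one₀ ContinuousLinearMap.norm_id_le (norm_nonneg _) (norm_W_pow_le _)
    refine (mul_le_of_le_one_left (norm_nonneg _) h1).trans ?_
    refine (ContinuousMultilinearMap.norm_compContinuousLinearMap_le _ _).trans ?_
    refine mul_le_of_le_one_right (norm_nonneg _) (Finset.prod_le_one (fun _ _ => norm_nonneg _)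
      fun i _ => ?_)
    split_ifs
    · exact ContinuousLinearMap.opNorm_le_bound _ zero_le_one fun x => by
        simpa using norm_snd_le x
    · exact ContinuousLinearMap.opNorm_le_bound _ zero_le_one fun x => by
        simpa using norm_fst_le x
  calc ‖liftSeries p n‖ ≤ ∑ s : Finset (Fin n), ‖p n‖ := norm_sum_le_of_le _ fun s _ => h s
    _ = 2 ^ n * ‖p n‖ := by simp

/-- Expand p multilinearly at (ε, wζ) = w(0, ζ) + (ε, 0): the term in which the slots of s receive
the first summand carries the factor w^{|s|}, whence `W ^ s.card` in the definition. -/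
lemma ev_liftSeries (p : FormalMultilinearSeries ℂ (E × ℂ) ℂ) (n : ℕ) {w : ℂ} (hw : ‖w‖ < 1)
    (x : E × ℂ) : ev w (liftSeries p n fun _ => x) = p n fun _ => (x.1, w * x.2) := by
  have hx : (fun _ : Fin n => (x.1, w * x.2)) =
      (fun _ : Fin n => w • ((0, x.2) : E × ℂ)) + fun _ => (x.1, 0) := by
    funext i
    simp
  rw [hx, (p n).map_add_univ, liftSeries, sum_apply, map_sum]
  refine Finset.sum_congr rfl fun s _ => ?_
  have h2 : s.piecewise (fun _ : Fin n => w • ((0, x.2) : E × ℂ)) (fun _ => (x.1, 0)) =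
      s.piecewise (fun i => (fun _ => w) i •
        (s.piecewise (fun _ : Fin n => ((0, x.2) : E × ℂ)) (fun _ => (x.1, 0))) i)
        (s.piecewise (fun _ : Fin n => ((0, x.2) : E × ℂ)) (fun _ => (x.1, 0))) := by
    funext i
    by_cases hi : i ∈ s <;> simp [hi]
  rw [h2, (p n).map_piecewise_smul]
  have h3 : (fun i => (if i ∈ s then ContinuousLinearMap.inr ℂ E ℂ ∘L ContinuousLinearMap.snd ℂ E ℂ
        else ContinuousLinearMap.inl ℂ E ℂ ∘L ContinuousLinearMap.fst ℂ E ℂ) x) =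
      s.piecewise (fun _ : Fin n => ((0, x.2) : E × ℂ)) (fun _ => (x.1, 0)) := by
    funext i
    by_cases hi : i ∈ s <;> simp [hi]
  simp [h3, ev_W_pow hw, mul_comm]

/-- An analytic germ `ω` on `E × ℂ` depends analytically on `(ε, ζ)` when `w ↦ ω (ε, w ζ)` is seen
as an element of the Wiener algebra. -/
theorem exists_analyticAt_lift {ω : E × ℂ → ℂ} (hω : AnalyticAt ℂ ω 0) :
    ∃ F : E × ℂ → WienerAlgebra, AnalyticAt ℂ F 0 ∧
      ∀ᶠ x in 𝓝 (0 : E × ℂ), ∀ w : ℂ, ‖w‖ < 1 → ev w (F x) = ω (x.1, w * x.2) := by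
  obtain ⟨p, r, hp⟩ := hω
  obtain ⟨ρ, hρ0, hρ⟩ := ENNReal.lt_iff_exists_nnreal_btwn.mp (hp.r_pos.trans_le hp.r_le)
  have hρ0' : 0 < ρ := by simpa using hρ0
  obtain ⟨C, hC, hpC⟩ := p.norm_mul_pow_le_of_lt_radius hρ
  have hrad : ((ρ / 2 : NNReal) : ENNReal) ≤ (liftSeries p).radius := by
    refine FormalMultilinearSeries.le_radius_of_bound _ C fun n => ?_
    refine le_trans ?_ (hpC n)
    refine (mul_le_mul_of_nonneg_right (norm_liftSeries_le p n) (by positivity)).trans_eq ?_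
    push_cast
    rw [div_pow]
    field_simp
  have hpos : 0 < (liftSeries p).radius :=
    lt_of_lt_of_le (by exact_mod_cast half_pos hρ0') hrad
  have hF := (liftSeries p).hasFPowerSeriesOnBall hpos
  refine ⟨(liftSeries p).sum, hF.analyticAt, ?_⟩
  filter_upwards [Metric.eball_mem_nhds (0 : E × ℂ) hpos,
    Metric.eball_mem_nhds (0 : E × ℂ) hp.r_pos] with x hx1 hx2 w hw
  have h1 := (hF.hasSum hx1).mapL (ev w)
  rw [zero_add] at h1
  have hx3 : ((x.1, w * x.2) : E × ℂ) ∈ Metric.eball (0 : E × ℂ) r := by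
    rw [Metric.mem_eball, edist_zero_right] at hx2 ⊢
    refine lt_of_le_of_lt ?_ hx2
    rw [enorm_le_iff_norm_le]
    simp only [Prod.norm_def]
    refine max_le_max le_rfl ?_
    rw [norm_mul]
    exact mul_le_of_le_one_left (norm_nonneg _) hw.le
  have h2 := hp.hasSum hx3
  rw [zero_add] at h2
  refine h1.unique ?_
  convert! h2 using 1
  funext n
  exact ev_liftSeries p n hw x

end Lift

end WienerAlgebra

open WienerAlgebra

/-! ### The conjugacy equation in the Banach space and its linearization. -/

/-- The polynomial `u^{k+1} + ∑_{j<k} b_j u^j` evaluated in a `ℂ`-algebra. -/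
def kPoly {k : ℕ} {A : Type*} [CommRing A] [Algebra ℂ A] (b : Fin k → ℂ) (u : A) : A :=
  u ^ (k + 1) + ∑ j : Fin k, b j • u ^ (j : ℕ)

/-- The derivative of `kPoly b`. -/
def kPolyDeriv {k : ℕ} {A : Type*} [CommRing A] [Algebra ℂ A] (b : Fin k → ℂ) (u : A) : A :=
  (k + 1 : ℕ) * u ^ k + ∑ j : Fin k, b j • (((j : ℕ) : A) * u ^ ((j : ℕ) - 1))

/-- Tuples `(f, (c, g), b, a)`: a vector field `f`, a coordinate change `φ` such that `φ - w` has
value `c` at `0` and derivative `g`, and the coefficients of a normal form. -/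
abbrev ModelSpace (k : ℕ) : Type :=
  WienerAlgebra × (ℂ × WienerAlgebra) × (Fin k → ℂ) × ℂ

/-- The coordinate change encoded by a point of the model space. -/
def coord {k : ℕ} (x : ModelSpace k) : WienerAlgebra := W + primitive x.2.1

/-- The denominator of the normal form in the new coordinate. -/
def denom {k : ℕ} (x : ModelSpace k) : WienerAlgebra := 1 + x.2.2.2 • coord x ^ k

/-- The defect of the conjugacy equation. -/
def residual {k : ℕ} (x : ModelSpace k) : WienerAlgebra :=
  (1 + x.2.1.2) * x.1 * denom x - kPoly x.2.2.1 (coord x)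

/-- The derivative of `residual` at `x` in the direction `v`. -/
def residualDeriv {k : ℕ} (x v : ModelSpace k) : WienerAlgebra :=
  v.2.1.2 * x.1 * denom x + (1 + x.2.1.2) * v.1 * denom x +
    (1 + x.2.1.2) * x.1 * (v.2.2.2 • coord x ^ k +
      x.2.2.2 • ((k : WienerAlgebra) * coord x ^ (k - 1) * primitive v.2.1)) -
    (kPolyDeriv x.2.2.1 (coord x) * primitive v.2.1 +
      ∑ j : Fin k, v.2.2.1 j • coord x ^ (j : ℕ))

/-- The conjugacy problem, with the coefficient of `w^{k+1}` of the coordinate change as a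
normalization. -/
def modelMap {k : ℕ} (x : ModelSpace k) : WienerAlgebra × ℂ × WienerAlgebra :=
  (x.1, cf (primitive x.2.1) (k + 1), residual x)

/-- The vector field `w^{k+1}` with the identity as conjugacy. -/
def basePoint (k : ℕ) : ModelSpace k := (W ^ (k + 1), 0, 0, 0)

section Projections

variable {E F : Type*} [NormedAddCommGroup E] [NormedSpace ℂ E] [NormedAddCommGroup F]
  [NormedSpace ℂ F]

lemma hasDerivAt_fst {x : ℂ → E × F} {v : E × F} {t : ℂ} (hx : HasDerivAt x v t) :
    HasDerivAt (fun s => (x s).1) v.1 t :=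
  (ContinuousLinearMap.fst ℂ E F).hasFDerivAt.comp_hasDerivAt t hx

lemma hasDerivAt_snd {x : ℂ → E × F} {v : E × F} {t : ℂ} (hx : HasDerivAt x v t) :
    HasDerivAt (fun s => (x s).2) v.2 t :=
  (ContinuousLinearMap.snd ℂ E F).hasFDerivAt.comp_hasDerivAt t hx

end Projections

lemma hasDerivAt_change {k : ℕ} {x : ℂ → ModelSpace k} {v : ModelSpace k} {t : ℂ}
    (hx : HasDerivAt x v t) : HasDerivAt (fun s => (x s).2.1) v.2.1 t :=
  hasDerivAt_fst (hasDerivAt_snd hx)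

lemma hasDerivAt_numer_coeff {k : ℕ} {x : ℂ → ModelSpace k} {v : ModelSpace k} {t : ℂ}
    (hx : HasDerivAt x v t) (j : Fin k) : HasDerivAt (fun s => (x s).2.2.1 j) (v.2.2.1 j) t :=
  hasDerivAt_pi.mp (hasDerivAt_fst (hasDerivAt_snd (hasDerivAt_snd hx))) j

lemma hasDerivAt_denom_coeff {k : ℕ} {x : ℂ → ModelSpace k} {v : ModelSpace k} {t : ℂ}
    (hx : HasDerivAt x v t) : HasDerivAt (fun s => (x s).2.2.2) v.2.2.2 t :=
  hasDerivAt_snd (hasDerivAt_snd (hasDerivAt_snd hx))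

lemma analyticAt_change {k : ℕ} (x : ModelSpace k) :
    AnalyticAt ℂ (fun y : ModelSpace k => y.2.1) x :=
  (ContinuousLinearMap.fst ℂ _ _ ∘L ContinuousLinearMap.snd ℂ _ _).analyticAt x

lemma analyticAt_numer_coeff {k : ℕ} (x : ModelSpace k) :
    AnalyticAt ℂ (fun y : ModelSpace k => y.2.2.1) x :=
  (ContinuousLinearMap.fst ℂ _ _ ∘L ContinuousLinearMap.snd ℂ _ _ ∘L
    ContinuousLinearMap.snd ℂ _ _).analyticAt x

lemma analyticAt_numer_coeff_apply {k : ℕ} (x : ModelSpace k) (j : Fin k) :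
    AnalyticAt ℂ (fun y : ModelSpace k => y.2.2.1 j) x :=
  ((ContinuousLinearMap.proj (R := ℂ) (φ := fun _ : Fin k => ℂ) j).analyticAt _).fun_comp
    (analyticAt_numer_coeff x)

lemma analyticAt_denom_coeff {k : ℕ} (x : ModelSpace k) :
    AnalyticAt ℂ (fun y : ModelSpace k => y.2.2.2) x :=
  (ContinuousLinearMap.snd ℂ _ _ ∘L ContinuousLinearMap.snd ℂ _ _ ∘L
    ContinuousLinearMap.snd ℂ _ _).analyticAt x

lemma hasDerivAt_coord {k : ℕ} {x : ℂ → ModelSpace k} {v : ModelSpace k} {t : ℂ}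
    (hx : HasDerivAt x v t) : HasDerivAt (fun s => coord (x s)) (primitive v.2.1) t :=
  (primitive.hasFDerivAt.comp_hasDerivAt t (hasDerivAt_change hx)).const_add W

lemma hasDerivAt_denom {k : ℕ} {x : ℂ → ModelSpace k} {v : ModelSpace k} {t : ℂ}
    (hx : HasDerivAt x v t) : HasDerivAt (fun s => denom (x s))
      (v.2.2.2 • coord (x t) ^ k +
      (x t).2.2.2 • ((k : WienerAlgebra) * coord (x t) ^ (k - 1) * primitive v.2.1)) t := by
  have h := ((hasDerivAt_denom_coeff hx).smul ((hasDerivAt_coord hx).pow k)).const_add (1 : WienerAlgebra)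
  convert! h using 1
  exact add_comm _ _

lemma hasDerivAt_kPoly {k : ℕ} {x : ℂ → ModelSpace k} {v : ModelSpace k} {t : ℂ}
    (hx : HasDerivAt x v t) : HasDerivAt (fun s => kPoly (x s).2.2.1 (coord (x s)))
      (kPolyDeriv (x t).2.2.1 (coord (x t)) * primitive v.2.1 +
      ∑ j : Fin k, v.2.2.1 j • coord (x t) ^ (j : ℕ)) t := by
  have h := ((hasDerivAt_coord hx).pow (k + 1)).add (HasDerivAt.fun_sum (u := Finset.univ)
    fun j _ => (hasDerivAt_numer_coeff hx j).smul ((hasDerivAt_coord hx).pow (j : ℕ)))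
  convert! h using 1
  rw [kPolyDeriv, Finset.sum_add_distrib, add_mul, Finset.sum_mul]
  simp only [smul_mul_assoc, Nat.add_sub_cancel]
  abel

lemma hasDerivAt_residual {k : ℕ} {x : ℂ → ModelSpace k} {v : ModelSpace k} {t : ℂ}
    (hx : HasDerivAt x v t) :
    HasDerivAt (fun s => residual (x s)) (residualDeriv (x t) v) t :=
  ((((hasDerivAt_snd (hasDerivAt_change hx)).const_add 1).mul (hasDerivAt_fst hx)).mul (hasDerivAt_denom hx)).sub (hasDerivAt_kPoly hx)
    |>.congr_deriv (by simp only [residualDeriv, Pi.mul_apply]; ring)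

lemma hasDerivAt_modelMap {k : ℕ} {x : ℂ → ModelSpace k} {v : ModelSpace k} {t : ℂ}
    (hx : HasDerivAt x v t) : HasDerivAt (fun s => modelMap (x s))
      (v.1, cf (primitive v.2.1) (k + 1), residualDeriv (x t) v) t :=
  (hasDerivAt_fst hx).prodMk ((((cfL (k + 1)).comp primitive).hasFDerivAt.comp_hasDerivAt t (hasDerivAt_change hx)).prodMk
    (hasDerivAt_residual hx))

lemma analyticAt_coord {k : ℕ} (x : ModelSpace k) :
    AnalyticAt ℂ (coord : ModelSpace k → WienerAlgebra) x :=
  analyticAt_const.add ((primitive.analyticAt _).comp (analyticAt_change x))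

lemma analyticAt_denom {k : ℕ} (x : ModelSpace k) :
    AnalyticAt ℂ (denom : ModelSpace k → WienerAlgebra) x :=
  analyticAt_const.add ((analyticAt_denom_coeff x).smul ((analyticAt_coord x).pow k))

lemma analyticAt_residual {k : ℕ} (x : ModelSpace k) :
    AnalyticAt ℂ (residual : ModelSpace k → WienerAlgebra) x := by
  refine AnalyticAt.sub (((analyticAt_const.add
    (analyticAt_snd.fun_comp (analyticAt_change x))).mul analyticAt_fst).mul (analyticAt_denom x))
    (((analyticAt_coord x).pow (k + 1)).add (Finset.analyticAt_fun_sum _ fun j _ =>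
      (analyticAt_numer_coeff_apply x j).smul ((analyticAt_coord x).pow _)))

lemma analyticAt_modelMap {k : ℕ} (x : ModelSpace k) :
    AnalyticAt ℂ (modelMap : ModelSpace k → _) x :=
  analyticAt_fst.prod (((((cfL (k + 1)).comp primitive).analyticAt _).comp
    (analyticAt_change x)).prod (analyticAt_residual x))

lemma coord_basePoint (k : ℕ) : coord (basePoint k) = W := by
  simp [coord, basePoint]

lemma denom_basePoint (k : ℕ) : denom (basePoint k) = 1 := by
  simp [denom, basePoint]

lemma residual_basePoint (k : ℕ) : residual (basePoint k) = 0 := by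
  rw [residual, denom_basePoint, coord_basePoint]
  simp [basePoint, kPoly]

lemma modelMap_basePoint (k : ℕ) : modelMap (basePoint k) = (W ^ (k + 1), 0, 0) := by
  rw [modelMap, residual_basePoint]
  simp [basePoint]

lemma residualDeriv_basePoint {k : ℕ} (v : ModelSpace k) :
    residualDeriv (basePoint k) v = v.1 + (W ^ (k + 1) * v.2.1.2 + v.2.2.2 • W ^ (2 * k + 1) -
      (k + 1 : ℂ) • (W ^ k * primitive v.2.1) - ∑ j : Fin k, v.2.2.1 j • W ^ (j : ℕ)) := by
  rw [residualDeriv, denom_basePoint, coord_basePoint]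
  simp only [basePoint, kPolyDeriv, Prod.snd_zero, Pi.zero_apply, zero_smul,
    Finset.sum_const_zero, add_zero, mul_one, one_mul, mul_smul_comm, add_smul, one_smul]
  rw [two_mul, add_right_comm k k 1, pow_add W (k + 1) k]
  have : (k : ℂ) • (W ^ k * primitive v.2.1) = k * (W ^ k * primitive v.2.1) := by
    rw [← nsmul_eq_mul, Nat.cast_smul_eq_nsmul]
  rw [this]
  push_cast
  ring

lemma cf_sum {ι : Type*} (s : Finset ι) (f : ι → WienerAlgebra) (n : ℕ) :
    cf (∑ i ∈ s, f i) n = ∑ i ∈ s, cf (f i) n :=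
  map_sum (cfL n) f s

lemma cf_residualDeriv_basePoint_lt {k : ℕ} (v : ModelSpace k) (n : Fin k) :
    cf (residualDeriv (basePoint k) v) n = cf v.1 n - v.2.2.1 n := by
  have h1 : ¬ k + 1 ≤ (n : ℕ) := by omega
  have h2 : (n : ℕ) ≠ 2 * k + 1 := by omega
  have h3 : ¬ k ≤ (n : ℕ) := by omega
  simp [residualDeriv_basePoint, cf_W_pow_mul, cf_W_pow, cf_sum, h1, h2, h3, Fin.val_inj]
  ring

lemma cf_residualDeriv_basePoint_self {k : ℕ} (hk : 1 ≤ k) (v : ModelSpace k) :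
    cf (residualDeriv (basePoint k) v) k = cf v.1 k - (k + 1) * v.2.1.1 := by
  have h2 : k ≠ 2 * k + 1 := by omega
  have h3 (j : Fin k) : k ≠ j := by omega
  simp [residualDeriv_basePoint, cf_W_pow_mul, cf_W_pow, cf_sum, h2, h3, cf_primitive_zero]
  ring

/-- With u the primitive of g, the coefficient of w^{k+1+i} in w^{k+1} g - (k+1) w^k u is g_i -
(k+1) g_i/(i+1). It vanishes identically exactly for i = k, the resonance absorbed by a. -/
lemma cf_residualDeriv_basePoint_add {k : ℕ} (v : ModelSpace k) (i : ℕ) :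
    cf (residualDeriv (basePoint k) v) (k + 1 + i) = cf v.1 (k + 1 + i) +
      ((i - k : ℂ) / (i + 1) * cf v.2.1.2 i + if i = k then v.2.2.2 else 0) := by
  have h2 : (k + 1 + i = 2 * k + 1) ↔ i = k := by omega
  have h3 (j : Fin k) : k + 1 + i ≠ j := by omega
  have h4 : k ≤ k + 1 + i := by omega
  have h5 : k + 1 + i - k = i + 1 := by omega
  have h6 : (i : ℂ) + 1 ≠ 0 := by exact_mod_cast i.succ_ne_zero
  simp [residualDeriv_basePoint, cf_W_pow_mul, cf_W_pow, cf_sum, h2, h3, h4, h5,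
    cf_primitive_succ]
  field_simp
  ring

/-- The coefficients decouple: w^n with n < k determines b_n, w^k determines c, w^{k+1+i} with i ≠ k
determines g_i, the normalization determines g_k, and w^{2k+1} determines a. The divisors
(i-k)/(i+1) have bounded inverses, so the solution is again summable. -/
lemma bijective_linearization {k : ℕ} (hk : 1 ≤ k) :
    Function.Bijective fun v : ModelSpace k =>
      ((v.1, cf (primitive v.2.1) (k + 1), residualDeriv (basePoint k) v) :
        WienerAlgebra × ℂ × WienerAlgebra) := by
  have hk1 : (k : ℂ) + 1 ≠ 0 := by exact_mod_cast k.succ_ne_zero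
  constructor
  · intro v v' h
    simp only [Prod.mk.injEq, cf_primitive_succ] at h
    obtain ⟨h1, h2, h3⟩ := h
    have h2 : cf v.2.1.2 k = cf v'.2.1.2 k := by field_simp at h2; exact h2
    have hb : v.2.2.1 = v'.2.2.1 := funext fun n => by
      have := congrArg (cf · n) h3
      simpa [cf_residualDeriv_basePoint_lt, h1] using this
    have hc : v.2.1.1 = v'.2.1.1 := by
      have := congrArg (cf · k) h3
      simpa [cf_residualDeriv_basePoint_self hk, h1, hk1] using this
    have ha : v.2.2.2 = v'.2.2.2 := by
      have := congrArg (cf · (k + 1 + k)) h3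
      simpa [cf_residualDeriv_basePoint_add, h1] using this
    have hg : v.2.1.2 = v'.2.1.2 := ext_cf fun i => by
      by_cases hi : i = k
      · rw [hi, h2]
      · have := congrArg (cf · (k + 1 + i)) h3
        have h6 : (i : ℂ) + 1 ≠ 0 := by exact_mod_cast i.succ_ne_zero
        have h7 : (i : ℂ) - k ≠ 0 := sub_ne_zero.mpr (by exact_mod_cast hi)
        simpa [cf_residualDeriv_basePoint_add, h1, hi, h6, h7] using this
    exact Prod.ext h1 (Prod.ext (Prod.ext hc hg) (Prod.ext hb ha))
  · rintro ⟨f, c, y⟩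
    set z := y - f with hz
    -- Write (i+1)/(i-k) = 1 + (k+1)/(i-k) and use that a nonzero integer has modulus at least 1.
    have hbound (i : ℕ) (hi : i ≠ k) : ‖((i : ℂ) + 1) / (i - k)‖ ≤ k + 2 := by
      have h7 : 1 ≤ ‖(i : ℂ) - k‖ := by
        have : ((i : ℂ) - k) = (((i : ℤ) - k : ℤ) : ℂ) := by push_cast; rfl
        rw [this, Complex.norm_intCast]
        have : (i : ℤ) - k ≠ 0 := by omega
        exact_mod_cast Int.one_le_abs this
      have h8 : ((i : ℂ) + 1) / (i - k) = 1 + (k + 1) / (i - k) := by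
        have : (i : ℂ) - k ≠ 0 := norm_pos_iff.mp (by linarith)
        field_simp
        ring
      rw [h8]
      refine (norm_add_le _ _).trans ?_
      rw [norm_one, norm_div]
      have h9 : ‖(k : ℂ) + 1‖ = k + 1 := by
        have : ((k : ℂ) + 1) = ((k + 1 : ℕ) : ℂ) := by push_cast; rfl
        rw [this, Complex.norm_natCast]
        push_cast
        rfl
      rw [h9]
      have := div_le_self (by positivity : (0 : ℝ) ≤ k + 1) h7
      linarith
    have hs : Summable fun i => ‖if i = k then (k + 1) * c else
        ((i : ℂ) + 1) / (i - k) * cf z (k + 1 + i)‖ := by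
      have h1 : Summable fun i => ((k : ℝ) + 2) * ‖cf z (k + 1 + i)‖ :=
        ((summable_norm z).comp_injective (add_right_injective (k + 1))).mul_left _
      have h2 : Summable fun i => if i = k then ‖(k + 1) * c‖ else 0 :=
        summable_of_ne_finset_zero (s := {k}) fun n hn => by
          simp only [Finset.mem_singleton] at hn
          simp [hn]
      refine Summable.of_nonneg_of_le (fun _ => norm_nonneg _) (fun i => ?_) (h1.add h2)
      split_ifs with hi
      · exact le_add_of_nonneg_left (by positivity)
      · rw [norm_mul, add_zero]
        exact mul_le_mul_of_nonneg_right (hbound i hi) (norm_nonneg _)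
    -- The diagonal system is solved for z = y - f. The entry (k+1)c at index k makes the
    -- coefficient of w^{k+1} in the primitive equal to c.
    refine ⟨(f, (-cf z k / (k + 1), ofCoeff _ hs), (fun n => -cf z n), cf z (k + 1 + k)), ?_⟩
    refine Prod.ext rfl (Prod.ext ?_ (ext_cf fun n => ?_))
    · simp only [cf_primitive_succ, cf_ofCoeff, if_true]
      field_simp
    · dsimp only
      rcases lt_trichotomy n k with hn | rfl | hn
      · have := cf_residualDeriv_basePoint_lt
          (f, (-cf z k / (k + 1), ofCoeff _ hs), (fun n => -cf z n), cf z (k + 1 + k)) ⟨n, hn⟩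
        refine this.trans ?_
        simp [hz]
      · rw [cf_residualDeriv_basePoint_self hk]
        simp only [hz, cf_sub]
        field_simp
        ring
      · obtain ⟨i, rfl⟩ := Nat.exists_eq_add_of_le (Nat.succ_le_of_lt hn)
        rw [Nat.succ_eq_add_one, cf_residualDeriv_basePoint_add, cf_ofCoeff]
        by_cases hi : i = k
        · subst hi
          simp [hz]
        · have h6 : (i : ℂ) + 1 ≠ 0 := by exact_mod_cast i.succ_ne_zero
          have h7 : (i : ℂ) - k ≠ 0 := sub_ne_zero.mpr (by exact_mod_cast hi)
          simp only [hi, if_false, hz, cf_sub]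
          field_simp
          ring

/-! ### Analytic inverse function theorem, and its use for the conjugacy problem. -/

section InverseFunction

variable {E F : Type*} [NormedAddCommGroup E] [NormedSpace ℂ E] [CompleteSpace E]
  [NormedAddCommGroup F] [NormedSpace ℂ F] [CompleteSpace F]

lemma exists_openPartialHomeomorph_of_bijective_fderiv {f : E → F} {a : E}
    (hf : AnalyticAt ℂ f a) (hbij : Function.Bijective (fderiv ℂ f a)) :
    ∃ R : OpenPartialHomeomorph E F, a ∈ R.source ∧ (∀ x, R x = f x) ∧
      AnalyticAt ℂ R.symm (f a) := by
  let i : E ≃L[ℂ] F := ContinuousLinearEquiv.ofBijective (fderiv ℂ f a)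
    (LinearMap.ker_eq_bot.mpr hbij.1) (LinearMap.range_eq_top.mpr hbij.2)
  have hi : (i : E →L[ℂ] F) = fderiv ℂ f a := ContinuousLinearEquiv.coe_ofBijective _ _ _
  have hstrict : HasStrictFDerivAt f (i : E →L[ℂ] F) a := hi ▸ hf.hasStrictFDerivAt
  exact ⟨hstrict.toOpenPartialHomeomorph _, hstrict.mem_toOpenPartialHomeomorph_source,
    fun x => rfl, OpenPartialHomeomorph.analyticAt_symm' (i := i) _
      hstrict.mem_toOpenPartialHomeomorph_source hf hi.symm⟩

lemma exists_analytic_localInverse {f : E → F} {a : E} (hf : AnalyticAt ℂ f a)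
    (hbij : Function.Bijective (fderiv ℂ f a)) :
    ∃ g : F → E, AnalyticAt ℂ g (f a) ∧ g (f a) = a ∧ (∀ᶠ x in 𝓝 a, g (f x) = x) ∧
      (∀ᶠ y in 𝓝 (f a), f (g y) = y) ∧ Function.Bijective (fderiv ℂ g (f a)) := by
  obtain ⟨R, ha, hR, hS⟩ := exists_openPartialHomeomorph_of_bijective_fderiv hf hbij
  have hgf : ∀ᶠ x in 𝓝 a, R.symm (f x) = x := by
    filter_upwards [R.open_source.mem_nhds ha] with x hx
    rw [← hR, R.left_inv hx]
  have hfg : ∀ᶠ y in 𝓝 (f a), f (R.symm y) = y := by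
    have : f a ∈ R.target := hR a ▸ R.map_source ha
    filter_upwards [R.open_target.mem_nhds this] with y hy
    rw [← hR, R.right_inv hy]
  have hga : R.symm (f a) = a := hgf.self_of_nhds
  refine ⟨R.symm, hS, hga, hgf, hfg, ?_⟩
  have h1 : HasFDerivAt f (fderiv ℂ f a) (R.symm (f a)) := by
    rw [hga]
    exact hf.differentiableAt.hasFDerivAt
  have h2 := hS.differentiableAt.hasFDerivAt
  have h3 : fderiv ℂ R.symm (f a) ∘L fderiv ℂ f a = ContinuousLinearMap.id ℂ E :=
    (h2.comp a hf.differentiableAt.hasFDerivAt).unique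
      ((hasFDerivAt_id a).congr_of_eventuallyEq hgf)
  have h4 : fderiv ℂ f a ∘L fderiv ℂ R.symm (f a) = ContinuousLinearMap.id ℂ F :=
    (h1.comp (f a) h2).unique ((hasFDerivAt_id (f a)).congr_of_eventuallyEq hfg)
  exact Function.bijective_iff_has_inverse.mpr ⟨fderiv ℂ f a, fun x => DFunLike.congr_fun h4 x,
    fun x => DFunLike.congr_fun h3 x⟩

end InverseFunction

/-- Analyticity already provides a Fréchet derivative, so computing along lines through the base
point identifies it with the bijective linearization. -/
lemma exists_localInverse {k : ℕ} (hk : 1 ≤ k) :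
    ∃ R : OpenPartialHomeomorph (ModelSpace k) (WienerAlgebra × ℂ × WienerAlgebra),
      basePoint k ∈ R.source ∧ (∀ x, R x = modelMap x) ∧
      AnalyticAt ℂ R.symm (W ^ (k + 1), 0, 0) := by
  rw [← modelMap_basePoint]
  refine exists_openPartialHomeomorph_of_bijective_fderiv (analyticAt_modelMap _) ?_
  have hdiff := (analyticAt_modelMap (basePoint k)).differentiableAt
  convert! bijective_linearization hk using 1
  funext v
  have hline : HasDerivAt (fun t : ℂ => basePoint k + t • v) v 0 := by
    simpa using ((hasDerivAt_id (0 : ℂ)).smul_const v).const_add (basePoint k)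
  have h1 := hasDerivAt_modelMap hline
  have h2 : HasDerivAt (fun t : ℂ => modelMap (basePoint k + t • v))
      (fderiv ℂ modelMap (basePoint k) v) 0 := by
    refine HasFDerivAt.comp_hasDerivAt (l := modelMap) 0 ?_ hline
    simpa using hdiff.hasFDerivAt
  simpa using h2.unique h1

/-- Every vector field close to `w^{k+1}` has a normal form depending analytically on it. -/
theorem exists_analytic_normalForm {k : ℕ} (hk : 1 ≤ k) :
    ∃ S : WienerAlgebra → ModelSpace k, AnalyticAt ℂ S (W ^ (k + 1)) ∧
      S (W ^ (k + 1)) = basePoint k ∧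
      ∀ᶠ f in 𝓝 (W ^ (k + 1)), (S f).1 = f ∧ residual (S f) = 0 := by
  obtain ⟨R, hR0, hR, hS⟩ := exists_localInverse hk
  have hι : AnalyticAt ℂ (fun f : WienerAlgebra => (f, (0 : ℂ), (0 : WienerAlgebra)))
      (W ^ (k + 1)) := by fun_prop
  have htar : ((W ^ (k + 1), 0, 0) : WienerAlgebra × ℂ × WienerAlgebra) ∈ R.target := by
    rw [← modelMap_basePoint, ← hR]
    exact R.map_source hR0
  refine ⟨fun f => R.symm (f, 0, 0), AnalyticAt.fun_comp_of_eq hS hι rfl, ?_, ?_⟩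
  · dsimp only
    rw [← modelMap_basePoint, ← hR, R.left_inv hR0]
  · filter_upwards [hι.continuousAt.eventually (R.open_target.mem_nhds htar)] with f hf
    have := R.right_inv hf
    rw [hR, modelMap, Prod.mk.injEq, Prod.mk.injEq] at this
    exact ⟨this.1, this.2.2⟩

/-! ### Flow symmetries and uniqueness of the normal form. -/

lemma derivative_toPS_coord {k : ℕ} (x : ModelSpace k) :
    PowerSeries.derivative ℂ (toPS (coord x)) = toPS (1 + x.2.1.2) := by
  rw [coord, map_add, map_add, derivative_toPS_primitive, toPS_W, PowerSeries.derivative_X,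
    map_add, map_one]

lemma derivative_toPS_pow (u : WienerAlgebra) (n : ℕ) :
    PowerSeries.derivative ℂ (toPS (u ^ n)) =
      toPS ((n : WienerAlgebra) * u ^ (n - 1)) * PowerSeries.derivative ℂ (toPS u) := by
  rw [map_pow, PowerSeries.derivative_pow, map_mul, map_pow, map_natCast]

lemma derivative_smul (c : ℂ) (f : PowerSeries ℂ) :
    PowerSeries.derivative ℂ (c • f) = c • PowerSeries.derivative ℂ f :=
  Derivation.map_smul _ c f

lemma derivative_toPS_kPoly {k : ℕ} (b : Fin k → ℂ) (u : WienerAlgebra) :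
    PowerSeries.derivative ℂ (toPS (kPoly b u)) =
      toPS (kPolyDeriv b u) * PowerSeries.derivative ℂ (toPS u) := by
  simp only [kPoly, kPolyDeriv, map_add, map_sum, map_smul, derivative_smul, derivative_toPS_pow, add_mul,
    Finset.sum_mul, smul_mul_assoc, Nat.add_sub_cancel]

/-- The infinitesimal generator of the symmetries of a solution of the conjugacy problem. -/
lemma exists_symmetry {k : ℕ} {x : ModelSpace k} (hx : residual x = 0) (hu : IsUnit (denom x)) :
    ∃ e : ℂ × WienerAlgebra, primitive e = (1 + x.2.1.2) * x.1 ∧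
      residualDeriv x (0, e, 0, 0) = 0 := by
  obtain ⟨V, hV⟩ := hu.exists_right_inv
  -- φ' f is the velocity of φ composed with the flow of f, a motion that keeps f, b and a fixed.
  set z := (1 + x.2.1.2) * x.1 with hz
  set U' := x.2.2.2 • ((k : WienerAlgebra) * coord x ^ (k - 1)) * (1 + x.2.1.2) with hU'
  -- Differentiating z · `denom` = P_b(φ) and solving for z' exhibits z' as an element of the
  -- algebra, although differentiation does not preserve the algebra.
  set e := V * (kPolyDeriv x.2.2.1 (coord x) * (1 + x.2.1.2) - z * U') with he
  clear_value e U' z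
  have hzU : z * denom x = kPoly x.2.2.1 (coord x) := by
    rw [hz]
    exact sub_eq_zero.mp hx
  have hdU : PowerSeries.derivative ℂ (toPS (denom x)) = toPS U' := by
    rw [denom, map_add, map_add, map_one, PowerSeries.derivative_one, zero_add, map_smul, derivative_smul,
      derivative_toPS_pow, derivative_toPS_coord, hU', smul_mul_assoc, map_smul, ← map_mul]
  have hdz : PowerSeries.derivative ℂ (toPS z) = toPS e := by
    have h1 := congrArg (fun y => PowerSeries.derivative ℂ (toPS y)) hzU
    simp only [map_mul, Derivation.leibniz, smul_eq_mul, derivative_toPS_kPoly, hdU,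
      derivative_toPS_coord] at h1
    have h2 : toPS (denom x) * toPS V = 1 := by rw [← map_mul, hV, map_one]
    rw [he, map_mul, map_sub, map_mul, map_mul, ← h1]
    linear_combination (-PowerSeries.derivative ℂ (toPS z)) * h2
  refine ⟨(cf z 0, e), primitive_eq_of_derivative hdz, ?_⟩
  have heU : e * denom x = kPolyDeriv x.2.2.1 (coord x) * (1 + x.2.1.2) - z * U' := by
    rw [he]
    linear_combination (kPolyDeriv x.2.2.1 (coord x) * (1 + x.2.1.2) - z * U') * hV
  rw [residualDeriv, primitive_eq_of_derivative hdz]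
  simp only [Pi.zero_apply, zero_smul, Finset.sum_const_zero, add_zero, zero_add, mul_zero,
    zero_mul, ← hz]
  have h3 : x.2.2.2 • ((k : WienerAlgebra) * coord x ^ (k - 1) * z) = U' * x.1 := by
    rw [hU', hz]
    simp only [smul_mul_assoc]
    congr 1
    ring
  rw [h3]
  -- The linearized residual in the direction e is f times the differentiated conjugacy equation.
  linear_combination x.1 * heU - kPolyDeriv x.2.2.1 (coord x) * hz

/-- Normal forms close to `w^{k+1}` which are conjugate by a map close to the identity
are equal. -/
theorem normalForm_unique {k : ℕ} (hk : 1 ≤ k) :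
    ∃ U ∈ 𝓝 (basePoint k), ∀ x₁ ∈ U, ∀ x₂ ∈ U, x₁.1 = x₂.1 → residual x₁ = 0 →
      residual x₂ = 0 → x₁.2.2 = x₂.2.2 := by
  obtain ⟨R, hR0, hR, hS⟩ := exists_localInverse hk
  set y₀ : WienerAlgebra × ℂ × WienerAlgebra := (W ^ (k + 1), 0, 0) with hy₀
  have hRb : R (basePoint k) = y₀ := by rw [hR, modelMap_basePoint]
  have htar : y₀ ∈ R.target := hRb ▸ R.map_source hR0
  have hSb : R.symm y₀ = basePoint k := by rw [← hRb, R.left_inv hR0]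
  have hunit : ∀ᶠ x : ModelSpace k in 𝓝 (R.symm y₀), IsUnit (denom x) := by
    refine (analyticAt_denom _).continuousAt.eventually ?_
    rw [hSb, denom_basePoint]
    exact Units.nhds 1
  -- This coefficient is the speed of the normalizing coefficient along the flow; it equals 1 at the
  -- base point.
  have hκ : ∀ᶠ x : ModelSpace k in 𝓝 (R.symm y₀), cf ((1 + x.2.1.2) * x.1) (k + 1) ≠ 0 := by
    have hc : Continuous fun x : ModelSpace k => cf ((1 + x.2.1.2) * x.1) (k + 1) :=
      (cfL (k + 1)).continuous.comp (f := fun x : ModelSpace k => (1 + x.2.1.2) * x.1)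
        (by fun_prop)
    refine hc.continuousAt.eventually_ne ?_
    rw [hSb]
    simp [basePoint, cf_W_pow]
  have hgood := ((hS.eventually_analyticAt.and (R.open_target.mem_nhds htar)).and
    (hS.continuousAt.eventually (hunit.and hκ)))
  obtain ⟨δ, hδ, hball⟩ := Metric.eventually_nhds_iff_ball.mp hgood
  -- For the sup metric, the slice of the ball with f fixed and zero residual is a disc in the
  -- normalizing coefficient, hence connected.
  refine ⟨R.source ∩ R ⁻¹' Metric.ball y₀ δ, inter_mem (R.open_source.mem_nhds hR0)
    (((R.continuousAt hR0).preimage_mem_nhds (hRb ▸ Metric.ball_mem_nhds y₀ hδ))), ?_⟩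
  rintro x₁ ⟨hs₁, hb₁⟩ x₂ ⟨hs₂, hb₂⟩ hf hr₁ hr₂
  set f := x₁.1 with hfdef
  have hline (c : ℂ) : HasDerivAt (fun s : ℂ => ((f, s, 0) : WienerAlgebra × ℂ × WienerAlgebra))
      (0, 1, 0) c :=
    (hasDerivAt_const c f).prodMk ((hasDerivAt_id c).prodMk (hasDerivAt_const c 0))
  have hmem (c : ℂ) (hc : c ∈ Metric.ball (0 : ℂ) δ) :
      ((f, c, 0) : WienerAlgebra × ℂ × WienerAlgebra) ∈ Metric.ball y₀ δ := by
    have h1 : dist f (W ^ (k + 1)) < δ := by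
      have : dist (R x₁) y₀ < δ := hb₁
      rw [hR, Prod.dist_eq] at this
      exact (le_max_left _ _).trans_lt this
    simp only [hy₀, Metric.mem_ball, Prod.dist_eq, dist_self, max_lt_iff] at hc ⊢
    exact ⟨h1, hc, hδ⟩
  -- The solutions over f form the curve s ↦ `R.symm (f, s, 0)`. Its velocity is the symmetry
  -- direction divided by κ, which has no component along (b, a).
  have hderiv (c : ℂ) (hc : c ∈ Metric.ball (0 : ℂ) δ) :
      HasDerivAt (fun s : ℂ => (R.symm (f, s, 0)).2.2) 0 c := by
    obtain ⟨⟨hSan, hyt⟩, hun, hκ⟩ := hball _ (hmem c hc)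
    set y : WienerAlgebra × ℂ × WienerAlgebra := (f, c, 0) with hy
    set x := R.symm y with hx
    have hxs : x ∈ R.source := R.map_target hyt
    have hRx : modelMap x = y := by rw [← hR, R.right_inv hyt]
    have hres : residual x = 0 := congrArg (fun p => p.2.2) hRx
    obtain ⟨e, he1, he2⟩ := exists_symmetry hres hun
    set v : ModelSpace k := (0, e, 0, 0) with hv
    have hx0 : x + (0 : ℂ) • v = x := by simp
    have hxline : HasDerivAt (fun t : ℂ => x + t • v) v 0 := by
      simpa using ((hasDerivAt_id (0 : ℂ)).smul_const v).const_add x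
    have hM := hasDerivAt_modelMap hxline
    rw [hx0, he2, he1] at hM
    have hM' : HasFDerivAt R.symm (fderiv ℂ R.symm y) (modelMap (x + (0 : ℂ) • v)) := by
      rw [hx0, hRx]
      exact hSan.differentiableAt.hasFDerivAt
    have h1 := hM'.comp_hasDerivAt (0 : ℂ) hM
    have h2 : HasDerivAt (R.symm ∘ fun t : ℂ => modelMap (x + t • v)) v 0 := by
      refine hxline.congr_of_eventuallyEq ?_
      have : ∀ᶠ t : ℂ in 𝓝 0, x + t • v ∈ R.source :=
        hxline.continuousAt.eventually (R.open_source.mem_nhds (by simpa using hxs))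
      filter_upwards [this] with t ht
      rw [Function.comp_apply, ← hR, R.left_inv ht]
    have h3 := h1.unique h2
    set κ := cf ((1 + x.2.1.2) * x.1) (k + 1) with hκdef
    have h4 : fderiv ℂ R.symm y (0, 1, 0) = κ⁻¹ • v := by
      rw [← h3, ← map_smul]
      simp [hv, inv_mul_cancel₀ hκ]
    have h5 := hSan.differentiableAt.hasFDerivAt.comp_hasDerivAt c (hline c)
    rw [h4] at h5
    have h6 := hasDerivAt_snd (hasDerivAt_snd h5)
    rwa [show (κ⁻¹ • v).2.2 = 0 by simp [hv]] at h6
  have key (x : ModelSpace k) (hs : x ∈ R.source) (hb : R x ∈ Metric.ball y₀ δ) (hxf : x.1 = f)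
      (hr : residual x = 0) : ∃ c ∈ Metric.ball (0 : ℂ) δ, R.symm (f, c, 0) = x := by
    refine ⟨cf (primitive x.2.1) (k + 1), ?_, ?_⟩
    · rw [hR, Metric.mem_ball, Prod.dist_eq, Prod.dist_eq] at hb
      have := (le_max_left _ _).trans_lt ((le_max_right _ _).trans_lt hb)
      exact this
    · conv_rhs => rw [← R.left_inv hs, hR, modelMap, hr, hxf]
  obtain ⟨c₁, hc₁, h₁⟩ := key x₁ hs₁ hb₁ rfl hr₁
  obtain ⟨c₂, hc₂, h₂⟩ := key x₂ hs₂ hb₂ hf.symm hr₂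
  rw [← h₁, ← h₂]
  refine (Metric.isOpen_ball (x := (0 : ℂ)) (ε := δ)).is_const_of_deriv_eq_zero
    (f := fun s : ℂ => (R.symm (f, s, 0)).2.2)
    (convex_ball (0 : ℂ) δ : Convex ℝ _).isPreconnected
    (fun c hc => (hderiv c hc).differentiableAt.differentiableWithinAt)
    (fun c hc => (hderiv c hc).deriv) hc₁ hc₂

/-! ### Rescaling an unfolding to a field close to w^{k+1}. -/

lemma exists_eq_pow_mul_of_isBigO {f : ℂ → ℂ} (hf : AnalyticAt ℂ f 0) (n : ℕ)
    (h : f =O[𝓝 0] fun z : ℂ => z ^ n) :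
    ∃ v : ℂ → ℂ, AnalyticAt ℂ v 0 ∧ ∀ᶠ z in 𝓝 0, f z = z ^ n * v z := by
  induction n with
  | zero => exact ⟨f, hf, by simp⟩
  | succ n ih =>
    have hpow : (fun z : ℂ => z ^ (n + 1)) =O[𝓝 0] fun z : ℂ => z ^ n := by
      simpa [pow_succ] using (isBigO_refl (fun z : ℂ => z ^ n) (𝓝 0)).mul
        ((continuous_id.tendsto (0 : ℂ)).isBigO_one ℂ)
    obtain ⟨v, hv, hfv⟩ := ih (h.trans hpow)
    have hvO : v =O[𝓝[≠] 0] fun z : ℂ => z := by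
      obtain ⟨C, hC⟩ := h.bound
      refine IsBigO.of_bound C ?_
      filter_upwards [nhdsWithin_le_nhds hC, nhdsWithin_le_nhds hfv, self_mem_nhdsWithin]
        with z h1 h2 h3
      have h3 : 0 < ‖z‖ ^ n := pow_pos (norm_pos_iff.mpr h3) n
      rw [h2, norm_mul, norm_pow, norm_pow, pow_succ, mul_left_comm] at h1
      exact le_of_mul_le_mul_left h1 h3
    have hv0 : v 0 = 0 := tendsto_nhds_unique
      (hv.continuousAt.tendsto.mono_left nhdsWithin_le_nhds)
      (hvO.trans_tendsto (tendsto_id.mono_left nhdsWithin_le_nhds))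
    obtain ⟨u, hu, hvu⟩ := (natCast_le_analyticOrderAt hv (n := 1)).mp (by
      rw [Nat.cast_one, Order.one_le_iff_ne_zero]
      exact hv.analyticOrderAt_ne_zero.mpr hv0)
    refine ⟨u, hu, ?_⟩
    filter_upwards [hfv, hvu] with z h1 h2
    rw [h1, h2]
    simp [pow_succ, mul_assoc]

/-- The rescaled fields `w ↦ ω (ε, ζ w)` as elements of the Wiener algebra. -/
lemma exists_scaled_family {k ℓ : ℕ} {ω : Family ℓ}
    (hω : AnalyticAt ℂ (fun p : (Fin ℓ → ℂ) × ℂ => ω p.1 p.2) (0, 0)) {v : ℂ → ℂ}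
    (hv : AnalyticAt ℂ v 0) (hωv : ∀ᶠ z in 𝓝 0, ω 0 z = z ^ (k + 1) + z ^ (k + 2) * v z) :
    ∃ F : (Fin ℓ → ℂ) × ℂ → WienerAlgebra, AnalyticAt ℂ F 0 ∧
      (∀ᶠ x in 𝓝 0, ∀ w : ℂ, ‖w‖ < 1 → ev w (F x) = ω x.1 (w * x.2)) ∧
      Tendsto (fun ζ : ℂ => (ζ ^ (k + 1))⁻¹ • F (0, ζ)) (𝓝[≠] 0) (𝓝 (W ^ (k + 1))) ∧
      ∀ᶠ ζ in 𝓝[≠] (0 : ℂ), W ^ (k + 1) ∣ (ζ ^ (k + 1))⁻¹ • F (0, ζ) := by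
  obtain ⟨F, hF, hFω⟩ := exists_analyticAt_lift hω
  refine ⟨F, hF, hFω, ?_⟩
  have hv' : AnalyticAt ℂ (fun p : (Fin ℓ → ℂ) × ℂ => v p.2) 0 :=
    AnalyticAt.fun_comp_of_eq hv analyticAt_snd rfl
  obtain ⟨H, hH, hHv⟩ := exists_analyticAt_lift hv'
  have hι : Tendsto (fun ζ : ℂ => ((0, ζ) : (Fin ℓ → ℂ) × ℂ)) (𝓝 0) (𝓝 0) :=
    (Continuous.prodMk_right _).tendsto' _ _ rfl
  -- Rescaling ω_0(z) = z^{k+1} + z^{k+2} v(z) gives w^{k+1} + ζ w^{k+2} v(ζ w). With v lifted to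
  -- the algebra as `H`, both the norm limit and the divisibility can be read off.
  have hlim : Tendsto (fun ζ : ℂ => W ^ (k + 1) + ζ • (W ^ (k + 2) * H (0, ζ))) (𝓝[≠] 0)
      (𝓝 (W ^ (k + 1))) := by
    have h1 : Tendsto (fun ζ : ℂ => W ^ (k + 1) + ζ • (W ^ (k + 2) * H (0, ζ))) (𝓝 0)
        (𝓝 (W ^ (k + 1) + (0 : ℂ) • (W ^ (k + 2) * H 0))) :=
      tendsto_const_nhds.add (tendsto_id.smul
        (tendsto_const_nhds.mul (hH.continuousAt.tendsto.comp hι)))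
    rw [zero_smul, add_zero] at h1
    exact h1.mono_left nhdsWithin_le_nhds
  suffices heq : (fun ζ : ℂ => W ^ (k + 1) + ζ • (W ^ (k + 2) * H (0, ζ))) =ᶠ[𝓝[≠] 0]
      fun ζ => (ζ ^ (k + 1))⁻¹ • F (0, ζ) by
    refine ⟨hlim.congr' heq, ?_⟩
    filter_upwards [heq] with ζ hζ
    refine ⟨1 + ζ • (W * H (0, ζ)), ?_⟩
    rw [← hζ, mul_add, mul_one, mul_smul_comm, ← mul_assoc, ← pow_succ]
  obtain ⟨δ, hδ, hball⟩ := Metric.eventually_nhds_iff_ball.mp hωv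
  filter_upwards [nhdsWithin_le_nhds (hι.eventually hFω), nhdsWithin_le_nhds (hι.eventually hHv),
    nhdsWithin_le_nhds (Metric.ball_mem_nhds (0 : ℂ) hδ), self_mem_nhdsWithin] with ζ h1 h2 h3 h4
  have h4 : ζ ≠ 0 := h4
  refine eq_of_ev_eq ?_
  filter_upwards [Metric.ball_mem_nhds (0 : ℂ) one_pos] with w hw
  have hw : ‖w‖ < 1 := by simpa using hw
  have h5 : w * ζ ∈ Metric.ball (0 : ℂ) δ := by
    rw [mem_ball_zero_iff] at h3 ⊢
    rw [norm_mul]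
    exact (mul_le_of_le_one_left (norm_nonneg _) hw.le).trans_lt h3
  simp only [map_add, map_smul, ev_mul hw, ev_W_pow hw, h1 w hw, h2 w hw, hball _ h5, smul_eq_mul]
  field_simp
  ring

/-! ### Conjugacy is symmetric and transitive. -/

section Conjugacy

variable {ℓ : ℕ}

lemma hasDerivAt_snd_of_differentiableAt {φ : (Fin ℓ → ℂ) → ℂ → ℂ} {p : (Fin ℓ → ℂ) × ℂ}
    (h : DifferentiableAt ℂ (fun p : (Fin ℓ → ℂ) × ℂ => φ p.1 p.2) p) :
    HasDerivAt (φ p.1) (fderiv ℂ (fun p : (Fin ℓ → ℂ) × ℂ => φ p.1 p.2) p (0, 1)) p.2 :=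
  HasFDerivAt.comp_hasDerivAt (l := fun p : (Fin ℓ → ℂ) × ℂ => φ p.1 p.2)
    (f := fun z : ℂ => (p.1, z)) p.2 h.hasFDerivAt ((hasDerivAt_const p.2 p.1).prodMk (hasDerivAt_id p.2))

lemma eventually_hasDerivAt {φ : (Fin ℓ → ℂ) → ℂ → ℂ} {p₀ : (Fin ℓ → ℂ) × ℂ}
    (h : AnalyticAt ℂ (fun p : (Fin ℓ → ℂ) × ℂ => φ p.1 p.2) p₀) :
    ∀ᶠ p : (Fin ℓ → ℂ) × ℂ in 𝓝 p₀, HasDerivAt (φ p.1) (deriv (φ p.1) p.2) p.2 := by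
  filter_upwards [h.eventually_analyticAt] with p hp
  exact (hasDerivAt_snd_of_differentiableAt hp.differentiableAt).differentiableAt.hasDerivAt

lemma analyticAt_deriv_snd {φ : (Fin ℓ → ℂ) → ℂ → ℂ} {p₀ : (Fin ℓ → ℂ) × ℂ}
    (h : AnalyticAt ℂ (fun p : (Fin ℓ → ℂ) × ℂ => φ p.1 p.2) p₀) :
    AnalyticAt ℂ (fun p : (Fin ℓ → ℂ) × ℂ => deriv (φ p.1) p.2) p₀ := by
  have h1 : AnalyticAt ℂ (fun p => fderiv ℂ (fun p : (Fin ℓ → ℂ) × ℂ => φ p.1 p.2) p (0, 1)) p₀ :=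
    ((ContinuousLinearMap.apply ℂ ℂ ((0, 1) : (Fin ℓ → ℂ) × ℂ)).analyticAt _).comp h.fderiv
  refine h1.congr ?_
  filter_upwards [h.eventually_analyticAt] with p hp
  exact (hasDerivAt_snd_of_differentiableAt hp.differentiableAt).deriv.symm

namespace IsConjugacy

variable {φ φ₁ φ₂ : (Fin ℓ → ℂ) → ℂ → ℂ} {h h₁ h₂ : (Fin ℓ → ℂ) → Fin ℓ → ℂ}
  {ω₁ ω₂ ω₃ : Family ℓ}

lemma analyticAt_prod (H : IsConjugacy φ h ω₁ ω₂) :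
    AnalyticAt ℂ (fun p : (Fin ℓ → ℂ) × ℂ => (h p.1, φ p.1 p.2)) (0, 0) :=
  (AnalyticAt.fun_comp_of_eq H.analytic_param analyticAt_fst rfl).prod H.analytic_coord

lemma prod_zero (H : IsConjugacy φ h ω₁ ω₂) : (h 0, φ 0 0) = (0, 0) := by
  rw [H.param_zero, H.coord_zero]

lemma tendsto (H : IsConjugacy φ h ω₁ ω₂) :
    Tendsto (fun p : (Fin ℓ → ℂ) × ℂ => (h p.1, φ p.1 p.2)) (𝓝 (0, 0)) (𝓝 (0, 0)) := by
  have := H.analyticAt_prod.continuousAt.tendsto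
  rwa [H.prod_zero] at this

theorem trans (H₁ : IsConjugacy φ₁ h₁ ω₁ ω₂) (H₂ : IsConjugacy φ₂ h₂ ω₂ ω₃) :
    IsConjugacy (fun ε z => φ₂ (h₁ ε) (φ₁ ε z)) (fun ε => h₂ (h₁ ε)) ω₁ ω₃ := by
  have hd : ∀ᶠ p : (Fin ℓ → ℂ) × ℂ in 𝓝 (0, 0),
      deriv (fun z => φ₂ (h₁ p.1) (φ₁ p.1 z)) p.2 =
        deriv (φ₂ (h₁ p.1)) (φ₁ p.1 p.2) * deriv (φ₁ p.1) p.2 := by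
    filter_upwards [eventually_hasDerivAt H₁.analytic_coord,
      H₁.tendsto.eventually (eventually_hasDerivAt H₂.analytic_coord)] with p hp1 hp2
    exact (hp2.comp p.2 hp1).deriv
  refine ⟨?_, ?_, ?_, ?_, ?_, ?_, ?_⟩
  · exact AnalyticAt.fun_comp_of_eq H₂.analytic_coord H₁.analyticAt_prod H₁.prod_zero
  · simp [H₁.param_zero, H₁.coord_zero, H₂.coord_zero]
  · have := hd.self_of_nhds
    simp only [H₁.param_zero, H₁.coord_zero] at this ⊢
    rw [this]
    exact mul_ne_zero H₂.deriv_coord_ne_zero H₁.deriv_coord_ne_zero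
  · exact AnalyticAt.fun_comp_of_eq H₂.analytic_param H₁.analytic_param H₁.param_zero
  · simp [H₁.param_zero, H₂.param_zero]
  · have h1 : DifferentiableAt ℂ h₂ (h₁ 0) := by
      rw [H₁.param_zero]
      exact H₂.analytic_param.differentiableAt
    have h2 := fderiv_fun_comp (0 : Fin ℓ → ℂ) h1 H₁.analytic_param.differentiableAt
    rw [h2, H₁.param_zero]
    exact H₂.bijective_fderiv_param.comp H₁.bijective_fderiv_param
  · filter_upwards [hd, H₁.conj, H₁.tendsto.eventually H₂.conj] with p hp1 hp2 hp3
    rw [hp1, mul_assoc, hp2, hp3]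

/-- The combined map (ε, z) ↦ (h(ε), φ(ε, z)) has a block triangular, invertible derivative. Since
its first component depends on ε only, the first component of its local inverse is the local inverse
of h. -/
theorem symm (H : IsConjugacy φ h ω₁ ω₂) : ∃ ψ g, IsConjugacy ψ g ω₂ ω₁ := by
  obtain ⟨g, hg, hg0, hgh, hhg, hgb⟩ :=
    exists_analytic_localInverse H.analytic_param H.bijective_fderiv_param
  rw [H.param_zero] at hg hg0 hhg hgb
  set Φ : (Fin ℓ → ℂ) × ℂ → (Fin ℓ → ℂ) × ℂ := fun p => (h p.1, φ p.1 p.2) with hΦ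
  have hΦ0 : Φ (0, 0) = (0, 0) := H.prod_zero
  have hφz : ∀ s : ℂ, fderiv ℂ (fun p : (Fin ℓ → ℂ) × ℂ => φ p.1 p.2) (0, 0) (0, s) =
      s * deriv (φ 0) 0 := by
    intro s
    have h1 := (hasDerivAt_snd_of_differentiableAt H.analytic_coord.differentiableAt).deriv
    dsimp only at h1
    rw [h1, ← smul_eq_mul, ← map_smul]
    simp
  have hfd : ∀ v : (Fin ℓ → ℂ) × ℂ, fderiv ℂ Φ (0, 0) v =
      (fderiv ℂ h 0 v.1, fderiv ℂ (fun p : (Fin ℓ → ℂ) × ℂ => φ p.1 p.2) (0, 0) v) := by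
    intro v
    have h1 : HasFDerivAt (fun p : (Fin ℓ → ℂ) × ℂ => h p.1)
        (fderiv ℂ h 0 ∘L ContinuousLinearMap.fst ℂ _ _) (0, 0) :=
      HasFDerivAt.comp (g := h) (f := Prod.fst) ((0, 0) : (Fin ℓ → ℂ) × ℂ)
        H.analytic_param.differentiableAt.hasFDerivAt hasFDerivAt_fst
    rw [(h1.prodMk H.analytic_coord.differentiableAt.hasFDerivAt).fderiv]
    rfl
  have hbij : Function.Bijective (fderiv ℂ Φ (0, 0)) := by
    constructor
    · refine (injective_iff_map_eq_zero _).mpr fun v hv => ?_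
      rw [hfd, Prod.mk_eq_zero] at hv
      have h1 : v.1 = 0 := H.bijective_fderiv_param.1 (by rw [hv.1, map_zero])
      have h2 : v = (0, v.2) := Prod.ext h1 rfl
      have h3 := hv.2
      rw [h2, hφz] at h3
      have h4 := (mul_eq_zero.mp h3).resolve_right H.deriv_coord_ne_zero
      rw [h2, h4]
      rfl
    · rintro ⟨a, c⟩
      obtain ⟨v, hv⟩ := H.bijective_fderiv_param.2 a
      set d := fderiv ℂ (fun p : (Fin ℓ → ℂ) × ℂ => φ p.1 p.2) (0, 0) (v, 0) with hd
      refine ⟨(v, (c - d) / deriv (φ 0) 0), ?_⟩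
      have h1 : ((v, (c - d) / deriv (φ 0) 0) : (Fin ℓ → ℂ) × ℂ) =
          (v, 0) + (0, (c - d) / deriv (φ 0) 0) := by simp
      rw [hfd, hv]
      refine Prod.ext rfl ?_
      dsimp only
      rw [h1, map_add, hφz, ← hd, div_mul_cancel₀ _ H.deriv_coord_ne_zero]
      ring
  obtain ⟨G, hG, hG0, -, hΦG, -⟩ := exists_analytic_localInverse H.analyticAt_prod hbij
  change AnalyticAt ℂ G (Φ (0, 0)) at hG
  change G (Φ (0, 0)) = (0, 0) at hG0
  change ∀ᶠ y in 𝓝 (Φ (0, 0)), Φ (G y) = y at hΦG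
  rw [hΦ0] at hG hG0 hΦG
  set ψ : (Fin ℓ → ℂ) → ℂ → ℂ := fun η y => (G (η, y)).2 with hψ
  have hGt : Tendsto G (𝓝 (0, 0)) (𝓝 (0, 0)) := by
    have := hG.continuousAt.tendsto
    rwa [hG0] at this
  have hG1 : ∀ᶠ p : (Fin ℓ → ℂ) × ℂ in 𝓝 (0, 0), (G p).1 = g p.1 := by
    have h1 : Tendsto (fun p => (G p).1) (𝓝 (0, 0)) (𝓝 0) :=
      (continuous_fst.tendsto ((0, 0) : (Fin ℓ → ℂ) × ℂ)).comp hGt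
    filter_upwards [h1.eventually hgh, hΦG] with p hp1 hp2
    have : h (G p).1 = p.1 := congrArg Prod.fst hp2
    rw [← this, hp1]
  have hψan : AnalyticAt ℂ (fun p : (Fin ℓ → ℂ) × ℂ => ψ p.1 p.2) (0, 0) :=
    analyticAt_snd.fun_comp hG
  have hφψ : ∀ᶠ p : (Fin ℓ → ℂ) × ℂ in 𝓝 (0, 0), φ (g p.1) (ψ p.1 p.2) = p.2 := by
    filter_upwards [hG1, hΦG] with p hp1 hp2
    rw [← hp1]
    exact congrArg Prod.snd hp2
  have hpair : Tendsto (fun p : (Fin ℓ → ℂ) × ℂ => (g p.1, ψ p.1 p.2)) (𝓝 (0, 0)) (𝓝 (0, 0)) := by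
    refine hGt.congr' ?_
    filter_upwards [hG1] with p hp
    exact Prod.ext hp rfl
  have hd : ∀ᶠ p : (Fin ℓ → ℂ) × ℂ in 𝓝 (0, 0),
      deriv (φ (g p.1)) (ψ p.1 p.2) * deriv (ψ p.1) p.2 = 1 := by
    filter_upwards [hφψ.eventually_nhds, eventually_hasDerivAt hψan,
      hpair.eventually (eventually_hasDerivAt H.analytic_coord)] with p hp1 hp2 hp3
    have h1 : HasDerivAt (fun z => φ (g p.1) (ψ p.1 z)) _ p.2 := hp3.comp p.2 hp2
    refine h1.unique ((hasDerivAt_id p.2).congr_of_eventuallyEq ?_)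
    have h2 : Tendsto (fun z : ℂ => (p.1, z)) (𝓝 p.2) (𝓝 p) :=
      (Continuous.prodMk_right p.1).tendsto' _ _ rfl
    exact h2.eventually hp1
  refine ⟨ψ, g, hψan, congrArg Prod.snd hG0, ?_, hg, hg0, hgb, ?_⟩
  · exact right_ne_zero_of_mul_eq_one hd.self_of_nhds
  · have hhgt : ∀ᶠ p : (Fin ℓ → ℂ) × ℂ in 𝓝 (0, 0), h (g p.1) = p.1 :=
      (continuous_fst.tendsto ((0, 0) : (Fin ℓ → ℂ) × ℂ)).eventually hhg
    filter_upwards [hd, hφψ, hpair.eventually H.conj, hhgt] with p hp1 hp2 hp3 hp4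
    rw [hp2, hp4] at hp3
    rw [← hp3]
    linear_combination (ω₁ (g p.1) (ψ p.1 p.2)) * hp1

end IsConjugacy

lemma Conjugate.symm {ω₁ ω₂ : Family ℓ} (H : Conjugate ω₁ ω₂) : Conjugate ω₂ ω₁ := by
  obtain ⟨φ, h, H⟩ := H
  exact H.symm

lemma Conjugate.trans {ω₁ ω₂ ω₃ : Family ℓ} (H₁ : Conjugate ω₁ ω₂) (H₂ : Conjugate ω₂ ω₃) :
    Conjugate ω₁ ω₃ := by
  obtain ⟨φ₁, h₁, H₁⟩ := H₁
  obtain ⟨φ₂, h₂, H₂⟩ := H₂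
  exact ⟨_, _, H₁.trans H₂⟩

end Conjugacy

/-! ### From conjugacies of germs to solutions of the Banach space problem. -/

lemma ev_kPoly {k : ℕ} {w : ℂ} (hw : ‖w‖ < 1) (b : Fin k → ℂ) (u : WienerAlgebra) :
    ev w (kPoly b u) = kPoly b (ev w u) := by
  simp [kPoly, ev_pow hw]

lemma ev_residual {k : ℕ} {w : ℂ} (hw : ‖w‖ < 1) (x : ModelSpace k) :
    ev w (residual x) = (1 + ev w x.2.1.2) * ev w x.1 * (1 + x.2.2.2 * ev w (coord x) ^ k) -
      kPoly x.2.2.1 (ev w (coord x)) := by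
  simp [residual, denom, ev_mul hw, ev_one hw, ev_pow hw, ev_kPoly hw]

/-- The coefficients of a normal form in the coordinate `w = z / ζ`. -/
def scaleCoeff {k : ℕ} (ζ : ℂ) (b : Fin k → ℂ) (j : Fin k) : ℂ := (ζ ^ (k + 1 - (j : ℕ)))⁻¹ * b j

/-- Weighted homogeneity: P_b has weight k+1 when u has weight 1 and b_j has weight k+1-j. -/
lemma kPoly_scaleCoeff {k : ℕ} {ζ : ℂ} (hζ : ζ ≠ 0) (b : Fin k → ℂ) (u : ℂ) :
    kPoly (scaleCoeff ζ b) (ζ⁻¹ * u) = (ζ ^ (k + 1))⁻¹ * kPoly b u := by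
  simp only [kPoly, mul_add, Finset.mul_sum, mul_pow, inv_pow, smul_eq_mul, scaleCoeff]
  congr 1
  refine Finset.sum_congr rfl fun j _ => ?_
  have h : ζ ^ (k + 1) = ζ ^ (k + 1 - (j : ℕ)) * ζ ^ (j : ℕ) := by
    rw [← pow_add]
    congr 1
    omega
  rw [h]
  field_simp

lemma scaleCoeff_injective {k : ℕ} {ζ : ℂ} (hζ : ζ ≠ 0) :
    Function.Injective (scaleCoeff ζ : (Fin k → ℂ) → Fin k → ℂ) := fun b b' h => by
  funext j
  have := congrFun h j
  simpa [scaleCoeff, hζ] using this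

/-- A conjugacy of germs to normal forms, with linear part the identity, gives solutions of the
model problem close to the base point in small discs. -/
lemma exists_scaled_solution {k ℓ : ℕ} (hk : 1 ≤ k) {ω : Family ℓ}
    {F : (Fin ℓ → ℂ) × ℂ → WienerAlgebra} (hF : AnalyticAt ℂ F 0)
    (hFω : ∀ᶠ x in 𝓝 0, ∀ w : ℂ, ‖w‖ < 1 → ev w (F x) = ω x.1 (w * x.2))
    (hlim : Tendsto (fun ζ : ℂ => (ζ ^ (k + 1))⁻¹ • F (0, ζ)) (𝓝[≠] 0) (𝓝 (W ^ (k + 1))))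
    {χ : (Fin ℓ → ℂ) → ℂ → ℂ} (hχ : AnalyticAt ℂ (fun p : (Fin ℓ → ℂ) × ℂ => χ p.1 p.2) (0, 0))
    (hχ0 : χ 0 0 = 0) (hχ1 : deriv (χ 0) 0 = 1) {b : (Fin ℓ → ℂ) → Fin k → ℂ}
    {A : (Fin ℓ → ℂ) → ℂ} (hb : ContinuousAt b 0) (hb0 : b 0 = 0) (hA : ContinuousAt A 0)
    (heq : ∀ᶠ p : (Fin ℓ → ℂ) × ℂ in 𝓝 (0, 0), deriv (χ p.1) p.2 * ω p.1 p.2 *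
      (1 + A p.1 * χ p.1 p.2 ^ k) = kPoly (b p.1) (χ p.1 p.2)) :
    ∃ X : (Fin ℓ → ℂ) → ℂ → ModelSpace k,
      (∀ ε ζ, (X ε ζ).1 = (ζ ^ (k + 1))⁻¹ • F (ε, ζ) ∧
        (X ε ζ).2.2 = (scaleCoeff ζ (b ε), A ε * ζ ^ k)) ∧
      ∀ U ∈ 𝓝 (basePoint k), ∀ᶠ ζ in 𝓝[≠] (0 : ℂ), ∀ᶠ ε in 𝓝 (0 : Fin ℓ → ℂ),
        X ε ζ ∈ U ∧ residual (X ε ζ) = 0 := by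
  obtain ⟨Y, hY, hYχ⟩ := exists_analyticAt_lift hχ
  obtain ⟨D, hD, hDχ⟩ := exists_analyticAt_lift (analyticAt_deriv_snd hχ)
  have hι : Tendsto (fun ζ : ℂ => ((0, ζ) : (Fin ℓ → ℂ) × ℂ)) (𝓝 0) (𝓝 0) :=
    (Continuous.prodMk_right _).tendsto' _ _ rfl
  have hD0 : D 0 = 1 := by
    refine eq_of_ev_eq ?_
    filter_upwards [Metric.ball_mem_nhds (0 : ℂ) one_pos] with w hw
    have hw : ‖w‖ < 1 := by simpa using hw
    rw [hDχ.self_of_nhds w hw, ev_one hw]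
    simpa using hχ1
  set X : (Fin ℓ → ℂ) → ℂ → ModelSpace k := fun ε ζ =>
    ((ζ ^ (k + 1))⁻¹ • F (ε, ζ), (ζ⁻¹ * χ ε 0, D (ε, ζ) - 1), scaleCoeff ζ (b ε), A ε * ζ ^ k)
    with hX
  -- The order of choices matters: `scaleCoeff` contains negative powers of ζ, harmless at ε = 0
  -- because b(0) = 0. So ζ is made small along ε = 0 first, and for that fixed ζ continuity in ε
  -- gives the rest.
  have hXlim : Tendsto (X 0) (𝓝[≠] 0) (𝓝 (basePoint k)) := by
    have h1 : Tendsto (fun ζ : ℂ => D (0, ζ) - 1) (𝓝[≠] 0) (𝓝 0) := by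
      have := ((hD.continuousAt.tendsto.comp hι).sub_const 1).mono_left
        (nhdsWithin_le_nhds (s := {0}ᶜ))
      rwa [hD0, sub_self] at this
    have h2 : Tendsto (fun ζ : ℂ => A 0 * ζ ^ k) (𝓝[≠] 0) (𝓝 0) := by
      refine Tendsto.mono_left ?_ nhdsWithin_le_nhds
      exact (Continuous.tendsto' (by fun_prop) _ _ (by simp [show k ≠ 0 by omega]))
    have h3 (ζ : ℂ) : scaleCoeff ζ (0 : Fin k → ℂ) = 0 := by
      funext j
      simp [scaleCoeff]
    simp only [hX, hχ0, hb0, h3, mul_zero]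
    exact hlim.prodMk_nhds ((tendsto_const_nhds.prodMk_nhds h1).prodMk_nhds
      (tendsto_const_nhds.prodMk_nhds h2))
  refine ⟨X, fun ε ζ => ⟨rfl, rfl⟩, fun U hU => ?_⟩
  obtain ⟨δ, hδ, hball⟩ := Metric.eventually_nhds_iff_ball.mp
    (heq.and (eventually_hasDerivAt hχ))
  filter_upwards [hXlim.eventually (eventually_mem_nhds_iff.mpr hU),
    nhdsWithin_le_nhds (hι.eventually hF.eventually_analyticAt),
    nhdsWithin_le_nhds (hι.eventually hD.eventually_analyticAt),
    nhdsWithin_le_nhds (hι.eventually hFω.eventually_nhds),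
    nhdsWithin_le_nhds (hι.eventually hYχ.eventually_nhds),
    nhdsWithin_le_nhds (hι.eventually hDχ.eventually_nhds),
    nhdsWithin_le_nhds (Metric.ball_mem_nhds (0 : ℂ) hδ), self_mem_nhdsWithin]
    with ζ hUζ hFζ hDζ hFωζ hYχζ hDχζ hζδ hζ
  have hζ : ζ ≠ 0 := hζ
  have hκ : ContinuousAt (fun ε : Fin ℓ → ℂ => (ε, ζ)) 0 := by fun_prop
  have hcont : ContinuousAt (fun ε => X ε ζ) 0 := by
    have h1 : ContinuousAt (fun ε => F (ε, ζ)) 0 := ContinuousAt.comp_of_eq hFζ.continuousAt hκ rfl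
    have h2 : ContinuousAt (fun ε => D (ε, ζ)) 0 := ContinuousAt.comp_of_eq hDζ.continuousAt hκ rfl
    have h3 : ContinuousAt (fun ε => χ ε 0) 0 := ContinuousAt.comp_of_eq
      hχ.continuousAt (by fun_prop : ContinuousAt (fun ε : Fin ℓ → ℂ => (ε, (0 : ℂ))) 0) rfl
    have h4 : ContinuousAt (fun ε => scaleCoeff ζ (b ε)) 0 := continuousAt_pi.mpr fun j =>
      continuousAt_const.mul (continuousAt_pi.mp hb j)
    have h5 : ContinuousAt (fun ε => (ζ ^ (k + 1))⁻¹ • F (ε, ζ)) 0 :=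
      ContinuousAt.comp_of_eq (continuous_const_smul (T := WienerAlgebra) _).continuousAt h1 rfl
    exact h5.prodMk (((h3.const_mul _).prodMk (h2.sub_const _)).prodMk
      (h4.prodMk (hA.mul_const _)))
  filter_upwards [hcont.eventually hUζ, hκ.eventually hFωζ, hκ.eventually hYχζ,
    hκ.eventually hDχζ, Metric.ball_mem_nhds (0 : Fin ℓ → ℂ) hδ] with ε h1 h2 h3 h4 h5
  refine ⟨h1, ?_⟩
  have hmem (w : ℂ) (hw : ‖w‖ < 1) :
      ((ε, w * ζ) : (Fin ℓ → ℂ) × ℂ) ∈ Metric.ball ((0, 0) : (Fin ℓ → ℂ) × ℂ) δ := by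
    rw [mem_ball_zero_iff] at hζδ
    rw [Metric.mem_ball, Prod.dist_eq, max_lt_iff]
    refine ⟨h5, ?_⟩
    rw [dist_zero_right, norm_mul]
    exact (mul_le_of_le_one_left (norm_nonneg _) hw.le).trans_lt hζδ
  have hcoord : coord (X ε ζ) = ζ⁻¹ • Y (ε, ζ) := by
    have : primitive (X ε ζ).2.1 = ζ⁻¹ • Y (ε, ζ) - W := by
      refine primitive_eq_of_hasDerivAt ?_ fun w hw => ?_
      · have := h3 0 (by simp)
        have h0 := ev_W_pow (w := 0) (by simp) 1
        rw [pow_one, pow_one] at h0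
        rw [map_sub, map_smul, this, h0]
        simp
      · have hd : HasDerivAt (fun w => ζ⁻¹ • χ ε (w * ζ) - w)
            (deriv (χ ε) (w * ζ) - 1) w := by
          have h6 : HasDerivAt (χ ε) (deriv (χ ε) (w * ζ)) (w * ζ) := (hball _ (hmem w hw)).2
          have h7 := ((h6.comp w ((hasDerivAt_id w).mul_const ζ)).const_smul ζ⁻¹).sub
            (hasDerivAt_id w)
          convert! h7 using 1
          rw [smul_eq_mul]
          field_simp
        have h8 : ev w (D (ε, ζ) - 1) = deriv (χ ε) (w * ζ) - 1 := by
          rw [map_sub, h4 w hw, ev_one hw]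
        rw [h8]
        refine hd.congr_of_eventuallyEq ?_
        filter_upwards [Metric.isOpen_ball.mem_nhds (mem_ball_zero_iff.mpr hw)] with v hv
        have hv : ‖v‖ < 1 := by simpa using hv
        have h0 := ev_W_pow hv 1
        rw [pow_one, pow_one] at h0
        rw [map_sub, map_smul, h3 v hv, h0]
    rw [coord, this]
    abel
  refine eq_of_ev_eq ?_
  filter_upwards [Metric.ball_mem_nhds (0 : ℂ) one_pos] with w hw
  have hw : ‖w‖ < 1 := by simpa using hw
  have h6 := (hball _ (hmem w hw)).1
  dsimp only at h6
  rw [ev_residual hw, hcoord, map_zero]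
  simp only [hX, map_sub, map_smul, smul_eq_mul, ev_one hw, h2 w hw, h3 w hw, h4 w hw]
  have h7 : A ε * ζ ^ k * (ζ⁻¹ * χ ε (w * ζ)) ^ k = A ε * χ ε (w * ζ) ^ k := by
    rw [mul_pow, inv_pow]
    field_simp
  rw [kPoly_scaleCoeff hζ, ← h6, h7]
  ring

/-- Two normal forms conjugate by a germ tangent to the identity coincide. -/
theorem eventually_eq_of_conjugate_tangent_id {k ℓ : ℕ} (hk : 1 ≤ k)
    {χ : (Fin ℓ → ℂ) → ℂ → ℂ} (hχ : AnalyticAt ℂ (fun p : (Fin ℓ → ℂ) × ℂ => χ p.1 p.2) (0, 0))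
    (hχ0 : χ 0 0 = 0) (hχ1 : deriv (χ 0) 0 = 1) {b₁ b₂ : (Fin ℓ → ℂ) → Fin k → ℂ}
    {A₁ A₂ : (Fin ℓ → ℂ) → ℂ} (hb₁ : ∀ j, AnalyticAt ℂ (fun ε => b₁ ε j) 0) (hb₁0 : b₁ 0 = 0)
    (hA₁ : AnalyticAt ℂ A₁ 0) (hb₂ : ContinuousAt b₂ 0) (hb₂0 : b₂ 0 = 0) (hA₂ : ContinuousAt A₂ 0)
    (heq : ∀ᶠ p : (Fin ℓ → ℂ) × ℂ in 𝓝 (0, 0),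
      deriv (χ p.1) p.2 * (kPoly (b₁ p.1) p.2 / (1 + A₁ p.1 * p.2 ^ k)) =
        kPoly (b₂ p.1) (χ p.1 p.2) / (1 + A₂ p.1 * χ p.1 p.2 ^ k)) :
    ∀ᶠ ε in 𝓝 0, b₁ ε = b₂ ε ∧ A₁ ε = A₂ ε := by
  have hk0 : k ≠ 0 := by omega
  set ω : Family ℓ := fun ε z => kPoly (b₁ ε) z / (1 + A₁ ε * z ^ k) with hω
  have hden : AnalyticAt ℂ (fun p : (Fin ℓ → ℂ) × ℂ => 1 + A₁ p.1 * p.2 ^ k) (0, 0) :=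
    analyticAt_const.add ((AnalyticAt.fun_comp_of_eq hA₁ analyticAt_fst rfl).mul
      (analyticAt_snd.pow k))
  have hωan : AnalyticAt ℂ (fun p : (Fin ℓ → ℂ) × ℂ => ω p.1 p.2) (0, 0) := by
    refine AnalyticAt.div ((analyticAt_snd.pow _).add (Finset.analyticAt_fun_sum _ fun j _ =>
      (AnalyticAt.fun_comp_of_eq (hb₁ j) analyticAt_fst rfl).smul (analyticAt_snd.pow _))) hden ?_
    simp [hk0]
  -- The remainder comes from z^{k+1}/(1 + A z^k) - z^{k+1} = -A z^{2k+1}/(1 + A z^k), with z^{k+2}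
  -- factored out.
  have hv : AnalyticAt ℂ (fun z : ℂ => -A₁ 0 * z ^ (k - 1) / (1 + A₁ 0 * z ^ k)) 0 :=
    AnalyticAt.div (by fun_prop) (by fun_prop) (by simp [hk0])
  have hωv : ∀ᶠ z in 𝓝 (0 : ℂ), ω 0 z = z ^ (k + 1) +
      z ^ (k + 2) * (-A₁ 0 * z ^ (k - 1) / (1 + A₁ 0 * z ^ k)) := by
    have hc : ContinuousAt (fun z : ℂ => 1 + A₁ 0 * z ^ k) 0 := by fun_prop
    filter_upwards [hc.eventually_ne (y := 0) (by simp [hk0])] with z hz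
    obtain ⟨m, rfl⟩ := Nat.exists_eq_succ_of_ne_zero hk0
    simp only [hω, hb₁0, kPoly, Pi.zero_apply, zero_smul, Finset.sum_const_zero, add_zero]
    rw [Nat.succ_eq_add_one] at hz ⊢
    rw [Nat.add_sub_cancel]
    field_simp
    ring
  obtain ⟨F, hF, hFω, hlim, -⟩ := exists_scaled_family hωan hv hωv
  have hid : ∀ᶠ p : (Fin ℓ → ℂ) × ℂ in 𝓝 (0, 0), deriv (fun z : ℂ => z) p.2 * ω p.1 p.2 *
      (1 + A₁ p.1 * p.2 ^ k) = kPoly (b₁ p.1) p.2 := by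
    filter_upwards [hden.continuousAt.eventually_ne (y := 0) (by simp [hk0])] with p hp
    rw [deriv_id'', one_mul, hω, div_mul_cancel₀ _ hp]
  have hχeq : ∀ᶠ p : (Fin ℓ → ℂ) × ℂ in 𝓝 (0, 0), deriv (χ p.1) p.2 * ω p.1 p.2 *
      (1 + A₂ p.1 * χ p.1 p.2 ^ k) = kPoly (b₂ p.1) (χ p.1 p.2) := by
    have hc : ContinuousAt (fun p : (Fin ℓ → ℂ) × ℂ => 1 + A₂ p.1 * χ p.1 p.2 ^ k) (0, 0) :=
      continuousAt_const.add ((ContinuousAt.comp' (x := ((0, 0) : (Fin ℓ → ℂ) × ℂ)) hA₂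
        continuousAt_fst).mul (hχ.continuousAt.pow k))
    filter_upwards [heq, hc.eventually_ne (y := 0) (by simp [hχ0, hk0])] with p hp1 hp2
    rw [hp1, div_mul_cancel₀ _ hp2]
  -- The identity and χ bring the same field to the two normal forms, so they give two solutions
  -- over the same f, to which uniqueness applies.
  obtain ⟨X₁, hX₁, hX₁U⟩ := exists_scaled_solution hk hF hFω hlim (χ := fun _ z => z)
    analyticAt_snd rfl (deriv_id _) (continuousAt_pi.mpr fun j => (hb₁ j).continuousAt) hb₁0
    hA₁.continuousAt hid
  obtain ⟨X₂, hX₂, hX₂U⟩ := exists_scaled_solution hk hF hFω hlim hχ hχ0 hχ1 hb₂ hb₂0 hA₂ hχeq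
  obtain ⟨U, hU, huniq⟩ := normalForm_unique hk
  obtain ⟨ζ, ⟨h1, h2⟩, hζ⟩ :=
    ((hX₁U U hU).and (hX₂U U hU)).and self_mem_nhdsWithin |>.exists
  have hζ : ζ ≠ 0 := hζ
  filter_upwards [h1, h2] with ε h1 h2
  have h3 := huniq _ h1.1 _ h2.1 ((hX₁ ε ζ).1.trans (hX₂ ε ζ).1.symm) h1.2 h2.2
  rw [(hX₁ ε ζ).2, (hX₂ ε ζ).2, Prod.mk.injEq] at h3
  exact ⟨scaleCoeff_injective hζ h3.1, mul_right_cancel₀ (pow_ne_zero k hζ) h3.2⟩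

/-! ### Kostov forms are rigid up to rotation. -/

lemma IsKostovForm.exists_kPoly {k ℓ : ℕ} {N : Family ℓ} (H : IsKostovForm k N) (hℓk : ℓ ≤ k) :
    ∃ (b : (Fin ℓ → ℂ) → Fin k → ℂ) (A : (Fin ℓ → ℂ) → ℂ), AnalyticAt ℂ A 0 ∧
      (∀ j, AnalyticAt ℂ (fun ε => b ε j) 0) ∧ b 0 = 0 ∧
      (∀ᶠ ε in 𝓝 0, ∀ j : Fin ℓ, b ε (j.castLE hℓk) = ε j) ∧
      ∀ᶠ p : (Fin ℓ → ℂ) × ℂ in 𝓝 (0, 0),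
        N p.1 p.2 = kPoly (b p.1) p.2 / (1 + A p.1 * p.2 ^ k) := by
  obtain ⟨b, A, hA, hb, hbε, hN⟩ := H
  refine ⟨fun ε j => b j ε, A, hA, fun j => (hb j j.2).1, funext fun j => (hb j j.2).2,
    eventually_all.mpr hbε, ?_⟩
  filter_upwards [hN] with p hp
  rw [hp, Finset.sum_range]
  rfl

lemma kPoly_mul_of_pow_eq_one {k : ℕ} {μ : ℂ} (hμ : μ ^ k = 1) (b : Fin k → ℂ) (u : ℂ) :
    kPoly b (μ * u) = μ * kPoly (fun j => μ⁻¹ * μ ^ (j : ℕ) * b j) u := by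
  rcases Nat.eq_zero_or_pos k with rfl | hk
  · simp [kPoly]
  have hμ0 : μ ≠ 0 := by
    rintro rfl
    simp [hk.ne'] at hμ
  simp only [kPoly, mul_add, Finset.mul_sum, mul_pow, smul_eq_mul]
  congr 1
  · rw [pow_succ, hμ]
    ring
  · refine Finset.sum_congr rfl fun j _ => ?_
    field_simp

/-- Dividing by z^{k+1} and letting z → 0 gives μ = μ^{k+1}, where μ = φ'(0) ≠ 0. -/
lemma deriv_pow_eq_one_of_conj {k : ℕ} (hk : 1 ≤ k) {φ : ℂ → ℂ} {A₁ A₂ : ℂ}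
    (hφ : AnalyticAt ℂ φ 0) (hφ0 : φ 0 = 0) (hφ1 : deriv φ 0 ≠ 0)
    (heq : ∀ᶠ z in 𝓝 (0 : ℂ), deriv φ z * (z ^ (k + 1) / (1 + A₁ * z ^ k)) =
      φ z ^ (k + 1) / (1 + A₂ * φ z ^ k)) : deriv φ 0 ^ k = 1 := by
  have hk0 : k ≠ 0 := by omega
  have hslope : Tendsto (fun z : ℂ => φ z / z) (𝓝[≠] 0) (𝓝 (deriv φ 0)) := by
    have := hasDerivAt_iff_tendsto_slope_zero.mp hφ.differentiableAt.hasDerivAt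
    refine this.congr fun z => ?_
    rw [zero_add, hφ0, sub_zero, smul_eq_mul, div_eq_inv_mul]
  have h1 : Tendsto (fun z : ℂ => deriv φ z / (1 + A₁ * z ^ k)) (𝓝[≠] 0) (𝓝 (deriv φ 0)) := by
    have hc : ContinuousAt (fun z : ℂ => deriv φ z / (1 + A₁ * z ^ k)) 0 :=
      hφ.deriv.continuousAt.div (by fun_prop) (by simp [hk0])
    have := hc.tendsto.mono_left (nhdsWithin_le_nhds (s := {0}ᶜ))
    simpa [hk0] using this
  have h2 : Tendsto (fun z : ℂ => (φ z / z) ^ (k + 1) / (1 + A₂ * φ z ^ k)) (𝓝[≠] 0)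
      (𝓝 (deriv φ 0 ^ (k + 1))) := by
    have hc : ContinuousAt (fun z : ℂ => 1 + A₂ * φ z ^ k) 0 :=
      continuousAt_const.add (continuousAt_const.mul (hφ.continuousAt.pow k))
    have := (hslope.pow (k + 1)).div (hc.tendsto.mono_left (nhdsWithin_le_nhds (s := {0}ᶜ)))
      (by simp [hφ0, hk0])
    rw [hφ0, zero_pow hk0, mul_zero, add_zero, div_one] at this
    exact this
  have h3 : deriv φ 0 = deriv φ 0 ^ (k + 1) := by
    refine tendsto_nhds_unique (h1.congr' ?_) h2
    filter_upwards [nhdsWithin_le_nhds heq, self_mem_nhdsWithin] with z hz hz0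
    have hz0 : z ≠ 0 := hz0
    rw [div_pow, div_right_comm, ← hz]
    field_simp
  rw [pow_succ] at h3
  exact mul_right_cancel₀ hφ1 (by rw [one_mul, ← h3])

/-- Conjugate Kostov normal forms are conjugate by a rotation. -/
theorem exists_rotation_of_conjugate {k ℓ : ℕ} (hk : 1 ≤ k) (hℓk : ℓ ≤ k) {N₁ N₂ : Family ℓ}
    (K₁ : IsKostovForm k N₁) (K₂ : IsKostovForm k N₂) (H : Conjugate N₁ N₂) :
    ∃ μ : ℂ, μ ^ k = 1 ∧ IsConjugacy (fun _ z => μ * z) (scaleParam μ) N₁ N₂ := by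
  obtain ⟨b₁, A₁, hA₁, hb₁, hb₁0, hb₁ε, hN₁⟩ := K₁.exists_kPoly hℓk
  obtain ⟨b₂, A₂, hA₂, hb₂, hb₂0, hb₂ε, hN₂⟩ := K₂.exists_kPoly hℓk
  obtain ⟨φ, h, H⟩ := H
  set μ := deriv (φ 0) 0 with hμdef
  have hμ0 : μ ≠ 0 := H.deriv_coord_ne_zero
  have hι : Tendsto (fun z : ℂ => ((0, z) : (Fin ℓ → ℂ) × ℂ)) (𝓝 0) (𝓝 (0, 0)) :=
    (Continuous.prodMk_right _).tendsto' _ _ rfl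
  have hφ₀ : AnalyticAt ℂ (φ 0) 0 := AnalyticAt.fun_comp_of_eq
    (f := fun z : ℂ => ((0, z) : (Fin ℓ → ℂ) × ℂ)) H.analytic_coord (by fun_prop) rfl
  have hN₂' := H.tendsto.eventually hN₂
  have hμ : μ ^ k = 1 := by
    refine deriv_pow_eq_one_of_conj hk (A₁ := A₁ 0) (A₂ := A₂ 0) hφ₀ H.coord_zero hμ0 ?_
    filter_upwards [hι.eventually H.conj, hι.eventually hN₁, hι.eventually hN₂'] with z h1 h2 h3
    rw [h2, h3, H.param_zero, hb₁0, hb₂0] at h1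
    simpa [kPoly] using h1
  have hht : Tendsto h (𝓝 0) (𝓝 0) := by
    simpa [H.param_zero] using H.analytic_param.continuousAt.tendsto
  have hχd (p : (Fin ℓ → ℂ) × ℂ) : deriv (fun z => μ⁻¹ * φ p.1 z) p.2 =
      μ⁻¹ * deriv (φ p.1) p.2 := deriv_const_mul_field _
  -- The map μ⁻¹φ is tangent to the identity and carries N₁ to the form obtained from N₂ at h(ε) by
  -- undoing the rotation. There b_j is multiplied by μ^{j-1}, and A is unchanged because μ^k = 1.
  have hcomp : ∀ᶠ ε in 𝓝 0, b₁ ε = (fun j : Fin k => μ⁻¹ * μ ^ (j : ℕ) * b₂ (h ε) j) ∧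
      A₁ ε = A₂ (h ε) := by
    refine eventually_eq_of_conjugate_tangent_id hk (χ := fun ε z => μ⁻¹ * φ ε z)
      (b₂ := fun ε j => μ⁻¹ * μ ^ (j : ℕ) * b₂ (h ε) j) (A₂ := fun ε => A₂ (h ε))
      (analyticAt_const.mul H.analytic_coord) (by simp [H.coord_zero]) ?_ hb₁ hb₁0 hA₁ ?_ ?_ ?_ ?_
    · rw [hχd (0, 0)]
      exact inv_mul_cancel₀ hμ0
    · exact continuousAt_pi.mpr fun j => continuousAt_const.mul
        (ContinuousAt.comp_of_eq (hb₂ j).continuousAt H.analytic_param.continuousAt H.param_zero)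
    · funext j
      simp [H.param_zero, hb₂0]
    · exact ContinuousAt.comp_of_eq hA₂.continuousAt H.analytic_param.continuousAt H.param_zero
    · filter_upwards [H.conj, hN₁, hN₂'] with p h1 h2 h3
      rw [h2, h3] at h1
      rw [hχd p, mul_assoc, h1]
      have h4 : φ p.1 p.2 = μ * (μ⁻¹ * φ p.1 p.2) := by field_simp
      rw [h4, kPoly_mul_of_pow_eq_one hμ, ← h4, mul_pow, inv_pow, hμ]
      field_simp
  -- For j < ℓ the coefficients are the parameters themselves, so the comparison reads ε_j = μ^{j-1}
  -- h_j(ε).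
  have hscale : h =ᶠ[𝓝 0] scaleParam μ := by
    filter_upwards [hcomp, hb₁ε, hht.eventually hb₂ε] with ε h1 h2 h3
    funext j
    have h4 := congrFun h1.1 (j.castLE hℓk)
    rw [h2, h3, Fin.val_castLE] at h4
    rw [scaleParam, h4, zpow_sub₀ hμ0, zpow_one, zpow_natCast]
    field_simp
  refine ⟨μ, hμ, analyticAt_const.mul analyticAt_snd, mul_zero μ, ?_, H.analytic_param.congr hscale,
    by funext j; simp [scaleParam], ?_, ?_⟩
  · simpa using hμ0
  · rw [← hscale.fderiv_eq]
    exact H.bijective_fderiv_param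
  · have h1 : Tendsto (fun p : (Fin ℓ → ℂ) × ℂ => (h p.1, μ * p.2)) (𝓝 (0, 0)) (𝓝 (0, 0)) := by
      have h2 : Tendsto (fun p : (Fin ℓ → ℂ) × ℂ => h p.1) (𝓝 (0, 0)) (𝓝 0) :=
        hht.comp (continuous_fst.tendsto _)
      have h3 : Tendsto (fun p : (Fin ℓ → ℂ) × ℂ => μ * p.2) (𝓝 (0, 0)) (𝓝 0) :=
        Continuous.tendsto' (by fun_prop) _ _ (by simp)
      exact h2.prodMk_nhds h3
    have hfst : Tendsto (fun p : (Fin ℓ → ℂ) × ℂ => p.1) (𝓝 (0, 0)) (𝓝 0) :=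
      continuous_fst.tendsto _
    filter_upwards [h1.eventually hN₂, hN₁, hfst.eventually hcomp, hfst.eventually hscale]
      with p h2 h3 h4 h5
    rw [← h5, h2, h3, kPoly_mul_of_pow_eq_one hμ, ← h4.1, ← h4.2, mul_pow, hμ, one_mul]
    simp [mul_div_assoc]

/-! ### Existence: the normal form at ε = 0, and the canonical parameters. -/

lemma iteratedDeriv_comp_mul_right (f : ℂ → ℂ) (c : ℂ) (n : ℕ) :
    iteratedDeriv n (fun w => f (w * c)) = fun w => c ^ n * iteratedDeriv n f (w * c) := by
  induction n with
  | zero => simp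
  | succ n ih =>
    funext w
    rw [iteratedDeriv_succ, ih, deriv_const_mul_field, iteratedDeriv_succ]
    simp_rw [mul_comm _ c]
    rw [deriv_comp_mul_left c (iteratedDeriv n f), smul_eq_mul]
    ring

/-- The polynomial `X^{k+1} + ∑ b_j X^j`. -/
def kPolynomial {k : ℕ} (b : Fin k → ℂ) : Polynomial ℂ :=
  Polynomial.X ^ (k + 1) + ∑ j : Fin k, Polynomial.C (b j) * Polynomial.X ^ (j : ℕ)

lemma aeval_kPolynomial {k : ℕ} {A : Type*} [CommRing A] [Algebra ℂ A] (b : Fin k → ℂ) (u : A) :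
    Polynomial.aeval u (kPolynomial b) = kPoly b u := by
  simp [kPolynomial, kPoly, Algebra.smul_def]

lemma degree_kPolynomial_tail {k : ℕ} (b : Fin k → ℂ) :
    (∑ j : Fin k, Polynomial.C (b j) * Polynomial.X ^ (j : ℕ)).degree < (k : WithBot ℕ) := by
  refine (Polynomial.degree_sum_le _ _).trans_lt ((Finset.sup_lt_iff (WithBot.bot_lt_coe k)).mpr
    fun j _ => (Polynomial.degree_C_mul_X_pow_le _ _).trans_lt ?_)
  exact WithBot.coe_lt_coe.mpr (Nat.cast_lt.mpr j.2)

lemma coeff_kPolynomial {k : ℕ} (b : Fin k → ℂ) (j : Fin k) :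
    (kPolynomial b).coeff j = b j := by
  have : (j : ℕ) ≠ k + 1 := by omega
  simp [kPolynomial, Polynomial.coeff_X_pow, this, Fin.val_inj]

lemma kPoly_map {k : ℕ} (b : Fin k → ℂ) (u : WienerAlgebra) :
    toPS (kPoly b u) = kPoly b (toPS u) := by
  simp [kPoly]

/-- If `kPoly b` vanishes at order `k + 1` along a coordinate, then `b = 0` and the coordinate
vanishes at the origin. -/
lemma eq_zero_of_X_pow_dvd_kPoly {k : ℕ} {b : Fin k → ℂ} {u : PowerSeries ℂ}
    (hu : PowerSeries.coeff 1 u ≠ 0) (h : PowerSeries.X ^ (k + 1) ∣ kPoly b u) :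
    b = 0 ∧ PowerSeries.constantCoeff u = 0 := by
  set p := PowerSeries.constantCoeff u with hp
  set P := kPolynomial b with hP
  have hdeg := degree_kPolynomial_tail b
  have hdeg1 : (∑ j : Fin k, Polynomial.C (b j) * Polynomial.X ^ (j : ℕ)).degree <
      ((k + 1 : ℕ) : WithBot ℕ) := hdeg.trans (by exact_mod_cast Nat.lt_succ_self k)
  have hmonic : P.Monic := Polynomial.monic_X_pow_add hdeg1
  have hnat : P.natDegree = k + 1 := by
    rw [hP, kPolynomial, Polynomial.natDegree_add_eq_left_of_degree_lt
      (by rwa [Polynomial.degree_X_pow]), Polynomial.natDegree_X_pow]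
  obtain ⟨v, hv⟩ : PowerSeries.X ∣ u - PowerSeries.C p := by
    rw [PowerSeries.X_dvd_iff]
    simp [hp]
  have hv0 : PowerSeries.constantCoeff v ≠ 0 := by
    have := congrArg (PowerSeries.coeff 1) hv
    rw [map_sub, PowerSeries.coeff_C, if_neg one_ne_zero, sub_zero, ← zero_add 1,
      PowerSeries.coeff_succ_X_mul, PowerSeries.coeff_zero_eq_constantCoeff] at this
    rwa [← this]
  obtain ⟨R, hR, hRdvd⟩ := Polynomial.exists_eq_pow_rootMultiplicity_mul_and_not_dvd P
    hmonic.ne_zero p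
  set m := P.rootMultiplicity p with hm
  have hR0 : PowerSeries.constantCoeff (Polynomial.aeval u R) ≠ 0 := by
    have h1 : PowerSeries.constantCoeff (Polynomial.aeval u R) = R.eval p := by
      rw [Polynomial.aeval_def, Polynomial.hom_eval₂, ← hp]
      have : (PowerSeries.constantCoeff (R := ℂ)).comp (algebraMap ℂ (PowerSeries ℂ)) =
          RingHom.id ℂ := by
        ext
        simp
      rw [this, Polynomial.eval₂_id]
    rw [h1]
    exact fun h => hRdvd (Polynomial.dvd_iff_isRoot.mpr h)
  -- u - p is X times a unit, so P(u) vanishes exactly to the order m of p as a root of P.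
  have h2 : kPoly b u = PowerSeries.X ^ m * (v ^ m * Polynomial.aeval u R) := by
    rw [← aeval_kPolynomial, ← hP]
    conv_lhs => rw [hR]
    have : algebraMap ℂ (PowerSeries ℂ) p = PowerSeries.C p := rfl
    rw [map_mul, map_pow, map_sub, Polynomial.aeval_X, Polynomial.aeval_C, this, hv]
    ring
  have hkm : k + 1 ≤ m := by
    by_contra hlt
    rw [h2, PowerSeries.X_pow_dvd_iff] at h
    have := h m (by omega)
    rw [PowerSeries.coeff_X_pow_mul', if_pos le_rfl, Nat.sub_self,
      PowerSeries.coeff_zero_eq_constantCoeff, map_mul, map_pow] at this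
    exact mul_ne_zero (pow_ne_zero m hv0) hR0 this
  have hPeq : P = (Polynomial.X - Polynomial.C p) ^ (k + 1) := by
    refine Polynomial.eq_of_monic_of_dvd_of_natDegree_le
      ((Polynomial.monic_X_sub_C p).pow (k + 1)) hmonic
      ((pow_dvd_pow _ hkm).trans ⟨R, hR⟩) ?_
    rw [hnat, Polynomial.natDegree_pow, Polynomial.natDegree_X_sub_C, mul_one]
  -- P has no term of degree k, while (X - p)^{k+1} has -(k+1)p there.
  have hp0 : p = 0 := by
    have h3 : P.coeff k = 0 := by
      rw [hP, kPolynomial, Polynomial.coeff_add, Polynomial.coeff_X_pow, if_neg (by omega),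
        zero_add, Polynomial.coeff_eq_zero_of_degree_lt hdeg]
    rw [hPeq, sub_eq_add_neg, ← Polynomial.C_neg, Polynomial.coeff_X_add_C_pow] at h3
    have hk1 : (k : ℂ) + 1 ≠ 0 := by exact_mod_cast k.succ_ne_zero
    simpa [hk1] using h3
  refine ⟨funext fun j => ?_, hp0⟩
  rw [← coeff_kPolynomial b j, ← hP, hPeq, hp0, Polynomial.C_0, sub_zero, Polynomial.coeff_X_pow,
    if_neg (by omega)]
  rfl

lemma X_pow_dvd_toPS_iff (n : ℕ) (y : WienerAlgebra) :
    PowerSeries.X ^ n ∣ toPS y ↔ ∀ m < n, cf y m = 0 := by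
  simp [PowerSeries.X_pow_dvd_iff]

/-- Applied at ε = 0: the equation transfers the order k+1 zero of the field to P_b along the
coordinate, whose linear coefficient is nonzero. -/
lemma numer_coeff_eq_zero {k : ℕ} {x : ModelSpace k} (hx : residual x = 0)
    (hf : W ^ (k + 1) ∣ x.1) (hg : 1 + cf x.2.1.2 0 ≠ 0) :
    x.2.2.1 = 0 ∧ cf (coord x) 0 = 0 := by
  have h1 : PowerSeries.X ^ (k + 1) ∣ kPoly x.2.2.1 (toPS (coord x)) := by
    rw [← kPoly_map, ← sub_eq_zero.mp hx, map_mul, map_mul]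
    obtain ⟨u, hu⟩ := hf
    refine Dvd.dvd.mul_right (Dvd.dvd.mul_left ?_ _) _
    rw [hu, map_mul, map_pow, toPS_W]
    exact dvd_mul_right _ _
  have h2 : PowerSeries.coeff 1 (toPS (coord x)) ≠ 0 := by
    have h3 := cf_primitive_succ x.2.1 0
    have h4 := cf_W_pow 1 1
    rw [pow_one] at h4
    rw [coeff_toPS, coord, cf_add, h4]
    simpa [h3] using hg
  have := eq_zero_of_X_pow_dvd_kPoly h2 h1
  rwa [← PowerSeries.coeff_zero_eq_constantCoeff_apply, coeff_toPS] at this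

/-- At a solution with `b = 0`, the first coefficients of a variation of the vector field vanish
with those of the normal form. -/
lemma cf_eq_zero_of_residualDeriv_eq_zero {k ℓ : ℕ} (hk : 1 ≤ k) (hℓk : ℓ ≤ k)
    {x v : ModelSpace k} (hf : W ^ (k + 1) ∣ x.1) (hg : 1 + cf x.2.1.2 0 ≠ 0) (hb : x.2.2.1 = 0)
    (hc : cf (coord x) 0 = 0) (hv : residualDeriv x v = 0)
    (hvb : ∀ j : Fin k, (j : ℕ) < ℓ → v.2.2.1 j = 0) : ∀ n < ℓ, cf v.1 n = 0 := by
  rw [← X_pow_dvd_toPS_iff]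
  have hX : PowerSeries.X ∣ toPS (coord x) := by
    rw [PowerSeries.X_dvd_iff, ← PowerSeries.coeff_zero_eq_constantCoeff_apply, coeff_toPS, hc]
  have hXn {m : ℕ} (hm : ℓ ≤ m) : PowerSeries.X ^ ℓ ∣ toPS (coord x) ^ m :=
    (pow_dvd_pow _ hm).trans (pow_dvd_pow_of_dvd hX m)
  have hf' : PowerSeries.X ^ ℓ ∣ toPS x.1 := by
    obtain ⟨u, hu⟩ := hf
    rw [hu, map_mul, map_pow, toPS_W]
    exact (pow_dvd_pow _ (by omega)).mul_right _
  -- The linearized equation is solved for the term containing the variation of f. Each remaining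
  -- term is divisible by X^ℓ: it contains f, or φ^k with φ(0) = 0, or φ^j with j ≥ ℓ, or a
  -- variation of b_j with j < ℓ, which vanishes.
  have h1 : toPS (1 + x.2.1.2) * toPS v.1 * toPS (denom x) =
      -(toPS v.2.1.2 * toPS x.1 * toPS (denom x)) - toPS (1 + x.2.1.2) * toPS x.1 *
      toPS (v.2.2.2 • coord x ^ k +
        x.2.2.2 • ((k : WienerAlgebra) * coord x ^ (k - 1) * primitive v.2.1)) +
      ((((k + 1 : ℕ) : PowerSeries ℂ) * toPS (coord x) ^ k) * toPS (primitive v.2.1) +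
        ∑ j : Fin k, v.2.2.1 j • toPS (coord x) ^ (j : ℕ)) := by
    have h2 := congrArg toPS hv
    rw [residualDeriv, hb] at h2
    simp only [kPolyDeriv, Pi.zero_apply, zero_smul, Finset.sum_const_zero, add_zero, map_sub,
      map_add, map_mul, map_zero, map_sum, map_smul, map_pow, map_natCast] at h2 ⊢
    linear_combination h2
  have h3 : PowerSeries.X ^ ℓ ∣ toPS (1 + x.2.1.2) * toPS v.1 * toPS (denom x) := by
    rw [h1]
    refine dvd_add (dvd_sub ((hf'.mul_left _).mul_right _).neg_right
      ((hf'.mul_left _).mul_right _)) (dvd_add (((hXn hℓk).mul_left _).mul_right _)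
        (Finset.dvd_sum fun j _ => ?_))
    by_cases hj : (j : ℕ) < ℓ
    · rw [hvb j hj, zero_smul]
      exact dvd_zero _
    · rw [Algebra.smul_def]
      exact (hXn (not_lt.mp hj)).mul_left _
  have hu1 : IsUnit (toPS (1 + x.2.1.2)) := by
    rw [PowerSeries.isUnit_iff_constantCoeff, ← PowerSeries.coeff_zero_eq_constantCoeff_apply,
      coeff_toPS, cf_add, cf_one]
    simpa using hg
  have hu2 : IsUnit (toPS (denom x)) := by
    have : PowerSeries.constantCoeff (toPS (coord x)) = 0 := PowerSeries.X_dvd_iff.mp hX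
    rw [PowerSeries.isUnit_iff_constantCoeff, denom, map_add, map_smul, map_pow, map_add, map_one,
      Algebra.smul_def, map_mul, map_pow, this, zero_pow (by omega)]
    simp
  rwa [hu2.dvd_mul_right, hu1.dvd_mul_left] at h3

/-- In a small disc, an unfolding of `z^{k+1} + O(z^{k+2})` is solved by an analytic family of
points of the model space. -/
lemma exists_analytic_solution {k ℓ : ℕ} (hk : 1 ≤ k) {ω : Family ℓ}
    (hω : AnalyticAt ℂ (fun p : (Fin ℓ → ℂ) × ℂ => ω p.1 p.2) (0, 0))
    (hpar : (fun z : ℂ => ω 0 z - z ^ (k + 1)) =O[𝓝 0] fun z : ℂ => z ^ (k + 2)) :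
    ∃ (ζ : ℂ) (X : (Fin ℓ → ℂ) → ModelSpace k), ζ ≠ 0 ∧ AnalyticAt ℂ X 0 ∧
      (∀ᶠ ε in 𝓝 0, residual (X ε) = 0) ∧ W ^ (k + 1) ∣ (X 0).1 ∧
      1 + cf (X 0).2.1.2 0 ≠ 0 ∧
      ∀ᶠ ε in 𝓝 0, ∀ w : ℂ, ‖w‖ < 1 → ev w (X ε).1 = (ζ ^ (k + 1))⁻¹ * ω ε (w * ζ) := by
  have hω₀ : AnalyticAt ℂ (ω 0) 0 := AnalyticAt.fun_comp_of_eq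
    (f := fun z : ℂ => ((0, z) : (Fin ℓ → ℂ) × ℂ)) hω (by fun_prop) rfl
  obtain ⟨v, hv, hωv⟩ := exists_eq_pow_mul_of_isBigO
    (hω₀.fun_sub (analyticAt_id.pow (k + 1))) (k + 2) hpar
  obtain ⟨F, hF, hFω, hlim, hdvd⟩ := exists_scaled_family (k := k) hω hv
    (hωv.mono fun z hz => by
      rw [← hz]
      simp)
  obtain ⟨S, hS, hS0, hSres⟩ := exists_analytic_normalForm hk
  have hg : ∀ᶠ f in 𝓝 (W ^ (k + 1)), 1 + cf (S f).2.1.2 0 ≠ 0 := by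
    have hc : Continuous fun x : ModelSpace k => 1 + cf x.2.1.2 0 :=
      continuous_const.add ((cfL 0).continuous.comp (by fun_prop :
        Continuous fun x : ModelSpace k => x.2.1.2))
    refine (ContinuousAt.comp' hc.continuousAt hS.continuousAt).eventually_ne ?_
    rw [hS0]
    simp [basePoint]
  have hι : Tendsto (fun ζ : ℂ => ((0, ζ) : (Fin ℓ → ℂ) × ℂ)) (𝓝 0) (𝓝 0) :=
    (Continuous.prodMk_right _).tendsto' _ _ rfl
  obtain ⟨ζ, ⟨⟨⟨⟨⟨⟨hSζ, hSresζ⟩, hgζ⟩, hFζ⟩, hFωζ⟩, hdvdζ⟩, hζ⟩⟩ :=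
    ((((((hlim.eventually hS.eventually_analyticAt).and
      (hlim.eventually hSres.eventually_nhds)).and (hlim.eventually hg)).and
      (nhdsWithin_le_nhds (hι.eventually hF.eventually_analyticAt))).and
      (nhdsWithin_le_nhds (hι.eventually hFω.eventually_nhds))).and hdvd).and
      self_mem_nhdsWithin |>.exists
  have hζ : ζ ≠ 0 := hζ
  have hf : AnalyticAt ℂ (fun ε : Fin ℓ → ℂ => (ζ ^ (k + 1))⁻¹ • F (ε, ζ)) 0 :=
    AnalyticAt.fun_const_smul (AnalyticAt.fun_comp_of_eq hFζ
      (by fun_prop : AnalyticAt ℂ (fun ε : Fin ℓ → ℂ => (ε, ζ)) 0) rfl)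
  have hκ : ContinuousAt (fun ε : Fin ℓ → ℂ => (ε, ζ)) 0 := by fun_prop
  have hSf := hf.continuousAt.eventually hSresζ
  refine ⟨ζ, fun ε => S ((ζ ^ (k + 1))⁻¹ • F (ε, ζ)), hζ, hSζ.fun_comp_of_eq hf rfl,
    hSf.mono fun ε h => h.2, ?_, hgζ, ?_⟩
  · rw [hSf.self_of_nhds.1]
    exact hdvdζ
  · filter_upwards [hSf, hκ.eventually hFωζ] with ε h1 h2 w hw
    rw [h1.1, map_smul, h2 w hw, smul_eq_mul]

/-- The Taylor coefficients of ω and of the rescaled field differ by the constant factor ζ^{k+1-n},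
so a vanishing first variation carries over to ω. -/
lemma fderiv_eq_zero_of_cf {k ℓ : ℕ} {ω : Family ℓ} {ζ : ℂ} (hζ : ζ ≠ 0)
    {X : (Fin ℓ → ℂ) → ModelSpace k} (hX : AnalyticAt ℂ X 0)
    (hXω : ∀ᶠ ε in 𝓝 0, ∀ w : ℂ, ‖w‖ < 1 → ev w (X ε).1 = (ζ ^ (k + 1))⁻¹ * ω ε (w * ζ)) {n : ℕ}
    {e : Fin ℓ → ℂ} (h : cf (fderiv ℂ X 0 e).1 n = 0) : fderiv ℂ (coeff ω n) 0 e = 0 := by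
  have hcoeff : coeff ω n =ᶠ[𝓝 0] fun ε => (ζ ^ (k + 1) * (ζ ^ n)⁻¹) *
      (cfL n ∘L ContinuousLinearMap.fst ℂ _ _) (X ε) := by
    filter_upwards [hXω] with ε hε
    have h1 : cf (X ε).1 n = _ := cf_eq_iteratedDeriv (f := fun w => (ζ ^ (k + 1))⁻¹ * ω ε (w * ζ))
      (by
        filter_upwards [Metric.ball_mem_nhds (0 : ℂ) one_pos] with w hw
        exact hε w (by simpa using hw)) n
    simp only [ContinuousLinearMap.comp_apply, ContinuousLinearMap.coe_fst', cfL_apply, coeff]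
    rw [h1, iteratedDeriv_const_mul_field, iteratedDeriv_comp_mul_right (ω ε) ζ n]
    simp only [zero_mul]
    field_simp
  have h2 := (((cfL n ∘L ContinuousLinearMap.fst ℂ WienerAlgebra
    ((ℂ × WienerAlgebra) × (Fin k → ℂ) × ℂ)).hasFDerivAt.comp (0 : Fin ℓ → ℂ)
    hX.differentiableAt.hasFDerivAt).const_mul (ζ ^ (k + 1) * (ζ ^ n)⁻¹))
  rw [hcoeff.fderiv_eq]
  refine (DFunLike.congr_fun h2.fderiv e).trans ?_
  simp [h]

lemma jacobian_mulVec {ℓ : ℕ} (ω : Family ℓ) (e : Fin ℓ → ℂ) (i : Fin ℓ) :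
    (jacobian ω).mulVec e i = fderiv ℂ (coeff ω i) 0 e := by
  change ∑ j, jacobian ω i j * e j = _
  conv_rhs => rw [pi_eq_sum_univ' e, map_sum]
  refine Finset.sum_congr rfl fun j _ => ?_
  rw [map_smul, smul_eq_mul, mul_comm]
  simp only [jacobian, Matrix.of_apply]

/-- Existence of Kostov normal forms. -/
theorem IsGenericUnfolding.exists_isKostovFormOf {k ℓ : ℕ} (hk : 1 ≤ k) (hℓk : ℓ ≤ k)
    {ω : Family ℓ} (H : IsGenericUnfolding k ω) : ∃ N, IsKostovFormOf k ω N := by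
  obtain ⟨ζ, X, hζ, hX, hres, hdvd, hg, hXω⟩ := exists_analytic_solution hk H.analytic H.parabolic
  obtain ⟨hb0, hc0⟩ := numer_coeff_eq_zero hres.self_of_nhds hdvd hg
  set b : (Fin ℓ → ℂ) → Fin k → ℂ := fun ε j => ζ ^ (k + 1 - (j : ℕ)) * (X ε).2.2.1 j with hb
  set A : (Fin ℓ → ℂ) → ℂ := fun ε => (X ε).2.2.2 * (ζ ^ k)⁻¹ with hA
  have hban (j : Fin k) : AnalyticAt ℂ (fun ε => b ε j) 0 :=
    analyticAt_const.mul ((analyticAt_numer_coeff_apply _ j).fun_comp hX)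
  have hAan : AnalyticAt ℂ A 0 := ((analyticAt_denom_coeff _).fun_comp hX).mul analyticAt_const
  have hb00 : b 0 = 0 := by
    funext j
    simp [hb, hb0]
  have hscale (ε : Fin ℓ → ℂ) : scaleCoeff ζ (b ε) = (X ε).2.2.1 := by
    funext j
    simp [scaleCoeff, hb, hζ]
  -- The first ℓ coefficients of the numerator are the candidate parameters of the normal form.
  set h : (Fin ℓ → ℂ) → Fin ℓ → ℂ := fun ε j => b ε (j.castLE hℓk) with hh
  have hhan : AnalyticAt ℂ h 0 := AnalyticAt.pi fun j => hban _
  have hh0 : h 0 = 0 := by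
    funext j
    simp [hh, hb00]
  -- If dh(0)e = 0, the linearized equation shows that c_0, …, c_{ℓ-1} are stationary along e, so
  -- the Jacobian matrix kills e and genericity gives e = 0.
  have hinj : Function.Injective (fderiv ℂ h 0) := by
    refine (injective_iff_map_eq_zero _).mpr fun e he => ?_
    have hline : HasDerivAt (fun t : ℂ => t • e) e 0 := by
      simpa using (hasDerivAt_id (0 : ℂ)).smul_const e
    have hX0 : HasFDerivAt X (fderiv ℂ X 0) ((0 : ℂ) • e) := by
      rw [zero_smul]
      exact hX.differentiableAt.hasFDerivAt
    have hXline : HasDerivAt (fun t : ℂ => X (t • e)) (fderiv ℂ X 0 e) 0 :=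
      hX0.comp_hasDerivAt 0 hline
    have hres0 : residualDeriv (X 0) (fderiv ℂ X 0 e) = 0 := by
      have h1 := hasDerivAt_residual hXline
      rw [zero_smul] at h1
      refine h1.unique ((hasDerivAt_const (0 : ℂ) (0 : WienerAlgebra)).congr_of_eventuallyEq ?_)
      have ht : Tendsto (fun t : ℂ => t • e) (𝓝 0) (𝓝 0) := by
        simpa using hline.continuousAt.tendsto
      exact ht.eventually hres
    have hvb : ∀ j : Fin k, (j : ℕ) < ℓ → (fderiv ℂ X 0 e).2.2.1 j = 0 := by
      intro j hj
      have hh' : HasFDerivAt h (fderiv ℂ h 0) ((0 : ℂ) • e) := by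
        rw [zero_smul]
        exact hhan.differentiableAt.hasFDerivAt
      have h1 := hasDerivAt_pi.mp (hh'.comp_hasDerivAt 0 hline) ⟨j, hj⟩
      have h2 := (hasDerivAt_numer_coeff hXline j).const_mul (ζ ^ (k + 1 - (j : ℕ)))
      have h3 := h2.unique h1
      rw [he] at h3
      exact (mul_eq_zero.mp h3).resolve_left (pow_ne_zero _ hζ)
    have hcf := cf_eq_zero_of_residualDeriv_eq_zero hk hℓk hdvd hg hb0 hc0 hres0 hvb
    refine Matrix.eq_zero_of_mulVec_eq_zero H.generic (funext fun i => ?_)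
    rw [jacobian_mulVec]
    exact fderiv_eq_zero_of_cf hζ hX hXω (hcf i i.2)
  have hbij : Function.Bijective (fderiv ℂ h 0) :=
    ⟨hinj, LinearMap.injective_iff_surjective.mp hinj⟩
  obtain ⟨g, hgan, hg0, hgh, hhg, -⟩ := exists_analytic_localInverse hhan hbij
  rw [hh0] at hgan hg0 hhg
  -- Undo the rescaling w = z/ζ in source and target.
  set φ : (Fin ℓ → ℂ) → ℂ → ℂ := fun ε z => ζ * ev (z * ζ⁻¹) (coord (X ε)) with hφ
  have hφan : AnalyticAt ℂ (fun p : (Fin ℓ → ℂ) × ℂ => φ p.1 p.2) (0, 0) := by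
    refine analyticAt_const.mul (AnalyticAt.fun_comp_of_eq
      (f := fun p : (Fin ℓ → ℂ) × ℂ => (coord (X p.1), p.2 * ζ⁻¹))
      (analyticAt_ev_apply (coord (X 0), 0) (by simp)) ?_ (by simp))
    exact (AnalyticAt.fun_comp_of_eq ((analyticAt_coord _).fun_comp hX) analyticAt_fst rfl).prod
      (analyticAt_snd.mul analyticAt_const)
  have hφd (ε : Fin ℓ → ℂ) {z : ℂ} (hz : ‖z * ζ⁻¹‖ < 1) :
      HasDerivAt (φ ε) (1 + ev (z * ζ⁻¹) (X ε).2.1.2) z := by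
    have h1 : HasDerivAt (fun w => ev w (coord (X ε))) (1 + ev (z * ζ⁻¹) (X ε).2.1.2)
        (z * ζ⁻¹) := by
      have hW : HasDerivAt (fun w => ev w W) 1 (z * ζ⁻¹) := by
        refine (hasDerivAt_id (z * ζ⁻¹)).congr_of_eventuallyEq ?_
        filter_upwards [Metric.isOpen_ball.mem_nhds (mem_ball_zero_iff.mpr hz)] with w hw
        simpa using ev_W_pow (by simpa using hw : ‖w‖ < 1) 1
      simpa only [coord, map_add] using hW.fun_add (hasDerivAt_ev_primitive (X ε).2.1 hz)
    have h2 := (h1.comp z ((hasDerivAt_id z).mul_const ζ⁻¹)).const_mul ζ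
    convert! h2 using 1
    field_simp
  have hdeg : 1 + A 0 * (0 : ℂ) ^ k ≠ 0 := by simp [show k ≠ 0 by omega]
  have hφ0 : φ 0 0 = 0 := by simp [hφ, ev_zero, hc0]
  have hNan : ∀ᶠ p : (Fin ℓ → ℂ) × ℂ in 𝓝 (0, 0), 1 + A p.1 * φ p.1 p.2 ^ k ≠ 0 := by
    have hc : ContinuousAt (fun p : (Fin ℓ → ℂ) × ℂ => 1 + A p.1 * φ p.1 p.2 ^ k) (0, 0) :=
      continuousAt_const.add ((ContinuousAt.comp' (x := ((0, 0) : (Fin ℓ → ℂ) × ℂ))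
        hAan.continuousAt continuousAt_fst).mul (hφan.continuousAt.pow k))
    exact hc.eventually_ne (by simpa only [hφ0] using hdeg)
  have hfst : Tendsto (fun p : (Fin ℓ → ℂ) × ℂ => p.1) (𝓝 (0, 0)) (𝓝 0) :=
    continuous_fst.tendsto _
  have hsmall : ∀ᶠ p : (Fin ℓ → ℂ) × ℂ in 𝓝 (0, 0), ‖p.2 * ζ⁻¹‖ < 1 := by
    have hc : ContinuousAt (fun p : (Fin ℓ → ℂ) × ℂ => ‖p.2 * ζ⁻¹‖) (0, 0) := by fun_prop
    exact hc.eventually_lt continuousAt_const (by simp)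
  -- Reparametrizing by the local inverse g of h turns b_j ∘ g into ε_j for j < ℓ; the value 0 for j
  -- ≥ k is a filler outside the sum.
  refine ⟨fun ε z => kPoly (b (g ε)) z / (1 + A (g ε) * z ^ k),
    ⟨fun j ε => if hj : j < k then b (g ε) ⟨j, hj⟩ else 0, fun ε => A (g ε), ?_, ?_, ?_, ?_⟩,
    φ, h, hφan, hφ0, ?_, hhan, hh0, hbij, ?_⟩
  · exact hAan.fun_comp_of_eq hgan hg0
  · intro j hj
    simp only [hj, dif_pos]
    exact ⟨(hban ⟨j, hj⟩).fun_comp_of_eq hgan hg0, by simp [hg0, hb00]⟩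
  · intro j
    filter_upwards [hhg] with ε hε
    rw [dif_pos (j.2.trans_le hℓk)]
    exact congrFun hε j
  · refine Eventually.of_forall fun p => ?_
    rw [Finset.sum_range]
    simp [kPoly]
  · rw [(hφd 0 (by simp)).deriv, zero_mul, ev_zero]
    exact hg
  · filter_upwards [hfst.eventually hgh, hfst.eventually hres, hfst.eventually hXω, hNan, hsmall]
      with p h1 h2 h3 h4 h5
    have h6 := congrArg (ev (p.2 * ζ⁻¹)) h2
    have h7 : ev (p.2 * ζ⁻¹) (coord (X p.1)) = ζ⁻¹ * φ p.1 p.2 := by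
      simp only [hφ]
      field_simp
    have h8 : p.2 * ζ⁻¹ * ζ = p.2 := by field_simp
    have h9 : (X p.1).2.2.2 * (ζ⁻¹ * φ p.1 p.2) ^ k = A p.1 * φ p.1 p.2 ^ k := by
      simp only [hA]
      rw [mul_pow, inv_pow]
      ring
    rw [ev_residual h5, map_zero, h3 _ h5, h7, h8, ← hscale, kPoly_scaleCoeff hζ, h9] at h6
    rw [(hφd p.1 h5).deriv, h1, eq_div_iff h4]
    have h10 : (ζ ^ (k + 1))⁻¹ ≠ 0 := inv_ne_zero (pow_ne_zero _ hζ)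
    refine mul_left_cancel₀ h10 ?_
    linear_combination h6

end ParabolicUnfolding

end

/-! ### Conclusion: existence, and transfer of conjugacies through the normal forms. -/

theorem mainTheorem3 (k ℓ : ℕ) (hℓ : 1 ≤ ℓ) (hℓk : ℓ ≤ k)
    (ω₁ ω₂ : ParabolicUnfolding.Family ℓ)
    (h₁ : ParabolicUnfolding.IsGenericUnfolding k ω₁)
    (h₂ : ParabolicUnfolding.IsGenericUnfolding k ω₂) :
    (∃ N₁, ParabolicUnfolding.IsKostovFormOf k ω₁ N₁) ∧
    (∃ N₂, ParabolicUnfolding.IsKostovFormOf k ω₂ N₂) ∧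
    ∀ N₁ N₂ : ParabolicUnfolding.Family ℓ,
      ParabolicUnfolding.IsKostovFormOf k ω₁ N₁ →
      ParabolicUnfolding.IsKostovFormOf k ω₂ N₂ →
      (ParabolicUnfolding.Conjugate ω₁ ω₂ ↔
        ∃ μ : ℂ, μ ^ k = 1 ∧
          ParabolicUnfolding.IsConjugacy (fun _ z => μ * z)
            (ParabolicUnfolding.scaleParam μ) N₁ N₂) := by
  have hk : 1 ≤ k := hℓ.trans hℓk
  refine ⟨h₁.exists_isKostovFormOf hk hℓk, h₂.exists_isKostovFormOf hk hℓk, ?_⟩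
  rintro N₁ N₂ ⟨K₁, c₁⟩ ⟨K₂, c₂⟩
  constructor
  · intro H
    exact ParabolicUnfolding.exists_rotation_of_conjugate hk hℓk K₁ K₂
      ((c₁.symm.trans H).trans c₂)
  · rintro ⟨μ, -, H⟩
    exact (c₁.trans ⟨_, _, H⟩).trans c₂.symm
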